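/- Throughout, $R$ is a commutative ring with identity and $C$ is a semidualizing $R$-module, i.e. $C$ has a projective resolution by finitely generated projective modules, the homothety map $R\to \mathrm{Hom}_R(C,C)$ is an isomorphism, and $\mathrm{Ext}_R^{n}(C,C)=0$ for all $n\ge 1$. A module is called $C$-projective (resp. $C$-flat) if it is isomorphic to $C\otimes_R P$ with $P$ projective (resp. to $C\otimes_R F$ with $F$ flat). Complexes $X=\cdots\to X^{n+1}\to X^{n}\to X^{n-1}\to\cdots$ of $R$-modules are indexed by $\mathbb Z$, and $\mathrm{Ch}(R)$ is the abelian category of such complexes. A complex is called projective (resp. $C$-projective, $C$-flat) if it is exact and all its cycle modules are projective (resp. $C$-projective, $C$-flat). An $R$-module $M$ is called $D_C$-projective if there is an exact sequence of $R$-modules $$\cdots\to T_1\to T_0\xrightarrow{\ \partial_0\ } T_{-1}\to T_{-2}\to\cdots$$ with $T_i$ projective for $i\ge 0$, $T_i$ $C$-projective for $i<0$ and $M\cong \mathrm{Im}\,\partial_0$, which stays exact after applying $\mathrm{Hom}_R(-,F)$ for every $C$-flat module $F$. A complex $X$ of $R$-modules is called $D_C$-projective if there is an exact sequence in $\mathrm{Ch}(R)$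 $$\cdots\to P_1\to P_0\xrightarrow{\ f_0\ } Q_{-1}\to Q_{-2}\to\cdots$$ with every $P_i$ a projective complex, every $Q_i$ a $C$-projective complex and $X\cong \mathrm{Im}\,f_0$, which stays exact after applying $\mathrm{Hom}_{\mathrm{Ch}(R)}(-,H)$ for every $C$-flat complex $H$. **Corollary 2.12.** Let $0\to X\to Y\to Z\to 0$ be a short exact sequence in $\mathrm{Ch}(R)$ with $X$ and $Y$ $D_C$-projective complexes. Then the following are equivalent: 1. $Z$ is a $D_C$-projective complex; 2. $Z^i$ is a $D_C$-projective $R$-module for every $i\in\mathbb Z$; 3. $\mathrm{Ext}^1_{\mathrm{Ch}(R)}(Z,H)=0$ for every $C$-flat complex $H$. -/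

import Mathlib

open CategoryTheory CategoryTheory.Limits

universe v u

namespace DingC

section Abelian

variable {A : Type u} [Category.{v} A] [Abelian A]

/-- `Hom(T, B)` is exact, i.e. for every `n` the sequence of abelian groups
`Hom(Tₙ₋₁, B) ⟶ Hom(Tₙ, B) ⟶ Hom(Tₙ₊₁, B)` is exact at the middle term. -/
def HomExact (T : ChainComplex A ℤ) (B : A) : Prop :=
  ∀ n : ℤ, Function.Exact
    (fun g : T.X (n - 1) ⟶ B => T.d n (n - 1) ≫ g)
    (fun g : T.X n ⟶ B => T.d (n + 1) n ≫ g)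

/-- There is a `Hom(-, F)`-exact exact sequence
`⋯ ⟶ T₁ ⟶ T₀ ⟶ T₋₁ ⟶ T₋₂ ⟶ ⋯` in the abelian category `A` with `Tᵢ ∈ P` for `i ≥ 0` and
`Tᵢ ∈ Q` for `i < 0` such that `M ≅ Im (T₀ ⟶ T₋₁)`. -/
def HasCompleteResolution (P Q F : ObjectProperty A) (M : A) : Prop :=
  ∃ T : ChainComplex A ℤ,
    T.Acyclic ∧
    (∀ B : A, F B → HomExact T B) ∧
    (∀ i : ℤ, 0 ≤ i → P (T.X i)) ∧
    (∀ i : ℤ, i < 0 → Q (T.X i)) ∧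
    Nonempty (M ≅ image (T.d 0 (-1)))

/-- The class of `𝒳`-complexes: exact complexes all of whose cycles `Zᵢ(X)` lie in `𝒳`. -/
def tildeClass (𝒳 : ObjectProperty A) : ObjectProperty (ChainComplex A ℤ) :=
  fun X => X.Acyclic ∧ ∀ i : ℤ, 𝒳 (X.cycles i)

end Abelian

variable {R : Type u} [CommRing R]

/-- Semidualizing modules over a commutative ring. -/
structure IsSemidualizing (C : ModuleCat.{u} R) : Prop where
  /-- `C` has a projective resolution by finitely generated modules. -/
  exists_resolution : ∃ P : ProjectiveResolution C, ∀ n : ℕ, Module.Finite R (P.complex.X n)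
  /-- The homothety map `R ⟶ Hom_R(C, C)`, `r ↦ (c ↦ r • c)`, is an isomorphism. -/
  homothety_bijective : Function.Bijective (LinearMap.lsmul R C)
  /-- `Ext^n(C, C) = 0` for all `n ≥ 1`. -/
  ext_eq_zero : ∀ n : ℕ, 1 ≤ n → Subsingleton (Abelian.Ext.{u} C C n)

/-- The class `𝒫(R)` of projective modules. -/
def projectiveModules (R : Type u) [CommRing R] : ObjectProperty (ModuleCat.{u} R) :=
  fun M => Module.Projective R M

/-- The class `𝒫_C(R)` of `C`-projective modules: the modules `C ⊗ P` with `P` projective,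
up to isomorphism. -/
def cProjectiveModules (C : ModuleCat.{u} R) : ObjectProperty (ModuleCat.{u} R) :=
  fun M => ∃ P : ModuleCat.{u} R, Module.Projective R P ∧
    Nonempty (M ≃ₗ[R] TensorProduct R C P)

/-- The class `ℱ_C(R)` of `C`-flat modules: the modules `C ⊗ F` with `F` flat,
up to isomorphism. -/
def cFlatModules (C : ModuleCat.{u} R) : ObjectProperty (ModuleCat.{u} R) :=
  fun M => ∃ F : ModuleCat.{u} R, Module.Flat R F ∧
    Nonempty (M ≃ₗ[R] TensorProduct R C F)

/-- Projective complexes: exact complexes with projective cycles. -/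
def projectiveComplexes (R : Type u) [CommRing R] :
    ObjectProperty (ChainComplex (ModuleCat.{u} R) ℤ) :=
  tildeClass (projectiveModules R)

/-- `C`-projective complexes: exact complexes with `C`-projective cycles. -/
def cProjectiveComplexes (C : ModuleCat.{u} R) :
    ObjectProperty (ChainComplex (ModuleCat.{u} R) ℤ) :=
  tildeClass (cProjectiveModules C)

/-- `C`-flat complexes: exact complexes with `C`-flat cycles. -/
def cFlatComplexes (C : ModuleCat.{u} R) :
    ObjectProperty (ChainComplex (ModuleCat.{u} R) ℤ) :=
  tildeClass (cFlatModules C)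

/-- `D_C`-projective modules. -/
def IsDCProjectiveModule (C M : ModuleCat.{u} R) : Prop :=
  HasCompleteResolution (projectiveModules R) (cProjectiveModules C) (cFlatModules C) M

/-- `D_C`-projective complexes; here the complete resolution is a sequence of complexes. -/
def IsDCProjectiveComplex (C : ModuleCat.{u} R) (X : ChainComplex (ModuleCat.{u} R) ℤ) : Prop :=
  HasCompleteResolution (projectiveComplexes R) (cProjectiveComplexes C) (cFlatComplexes C) X

end DingC

/-! The infinite left half of a complete resolution carries no information. There are enough
projective complexes, and a projective resolution of X is Hom(-, H)-exact as soon as Ext^n(X, H) = 0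
for n ≥ 1. So X is D_C-projective exactly when it has a coresolution by C-projective complexes all
of whose cosyzygies, X included, are left Ext-orthogonal to the C-flat complexes
(`isDCProjectiveComplex_iff`). This rests on Ext^n(C ⊗ P, C ⊗ F) = 0 for n ≥ 1, which passes to
complexes because a C-projective complex is a retract of a contractible one.

Contractible complexes link complexes to modules: maps into or out of them are arbitrary families of
maps of modules. For 1 → 2, evaluate the resolution in degree i and test it on the contractible
complex with constant value a C-flat module (`hasCompleteResolution_X`). For 2 → 3, write H as the
quotient of a contractible complex by a shift of H. A map X → H lifts to the contractible complex,
extends to Y degree by degree, and returns to H; as Ext^1(Y, H) = 0, this forces Ext^1(Z, H) = 0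
(`ext_one_of_degreewise`).

For 3 → 1, embed X in a C-projective E with good cokernel N. As E is also C-flat, X → E extends to
Y, giving 0 → Y → E ⊞ Z → N → 0. Hence E ⊞ Z has a coresolution, and its first term E' also contains
Z, with cokernel an extension of a good cosyzygy by E (`HasOrthogonalCoresolution.of_shortExact`).
-/

namespace DingC

/-! ### Vanishing of Ext along short exact sequences -/

section ExtVanishing

universe w

variable {A : Type u} [Category.{v} A] [Abelian A] [HasExt.{w} A]

/-- All higher extension groups `Ext^n(M, B)`, `n ≥ 1`, vanish. -/
def ExtOrthogonal.{w₁, v₁, u₁} {A : Type u₁} [Category.{v₁} A] [Abelian A] [HasExt.{w₁} A]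
    (M B : A) : Prop :=
  ∀ n : ℕ, Subsingleton (Abelian.Ext.{w₁} M B (n + 1))

lemma exists_extension_of_ext_one {S : ShortComplex A} (hS : S.ShortExact) {B : A}
    (h : Subsingleton (Abelian.Ext.{w} S.X₃ B 1)) (φ : S.X₁ ⟶ B) :
    ∃ ψ : S.X₂ ⟶ B, S.f ≫ ψ = φ := by
  obtain ⟨x, hx⟩ := Abelian.Ext.contravariant_sequence_exact₁ hS B (Abelian.Ext.mk₀ φ)
    (n₁ := 1) rfl (Subsingleton.elim _ _)
  obtain ⟨ψ, rfl⟩ := (Abelian.Ext.mk₀_bijective _ _).2 x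
  refine ⟨ψ, (Abelian.Ext.mk₀_bijective _ _).1 ?_⟩
  rw [← hx, Abelian.Ext.mk₀_comp_mk₀]

lemma ext_one_of_exists_extension {S : ShortComplex A} (hS : S.ShortExact) {B : A}
    (h : Subsingleton (Abelian.Ext.{w} S.X₂ B 1))
    (hB : ∀ φ : S.X₁ ⟶ B, ∃ ψ : S.X₂ ⟶ B, S.f ≫ ψ = φ) :
    Subsingleton (Abelian.Ext.{w} S.X₃ B 1) := by
  refine subsingleton_of_forall_eq 0 fun x => ?_
  obtain ⟨y, rfl⟩ := Abelian.Ext.contravariant_sequence_exact₃ hS B x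
    (Subsingleton.elim _ _) (n₀ := 0) rfl
  obtain ⟨φ, rfl⟩ := (Abelian.Ext.mk₀_bijective _ _).2 y
  obtain ⟨ψ, rfl⟩ := hB φ
  rw [← Abelian.Ext.mk₀_comp_mk₀, hS.extClass_comp_assoc]

lemma ext_X₃_of_ext {S : ShortComplex A} (hS : S.ShortExact) {B : A} {n : ℕ}
    (h₁ : Subsingleton (Abelian.Ext.{w} S.X₁ B n))
    (h₂ : Subsingleton (Abelian.Ext.{w} S.X₂ B (n + 1))) :
    Subsingleton (Abelian.Ext.{w} S.X₃ B (n + 1)) := by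
  refine subsingleton_of_forall_eq 0 fun x => ?_
  obtain ⟨y, rfl⟩ := Abelian.Ext.contravariant_sequence_exact₃ hS B x
    (Subsingleton.elim _ _) (n₀ := n) (add_comm _ _)
  rw [Subsingleton.elim y 0, Abelian.Ext.comp_zero]

lemma ext_X₂_of_ext {S : ShortComplex A} (hS : S.ShortExact) {B : A} {n : ℕ}
    (h₁ : Subsingleton (Abelian.Ext.{w} S.X₁ B n))
    (h₃ : Subsingleton (Abelian.Ext.{w} S.X₃ B n)) :
    Subsingleton (Abelian.Ext.{w} S.X₂ B n) := by
  refine subsingleton_of_forall_eq 0 fun x => ?_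
  obtain ⟨y, rfl⟩ := Abelian.Ext.contravariant_sequence_exact₂ hS B x (Subsingleton.elim _ _)
  rw [Subsingleton.elim y 0, Abelian.Ext.comp_zero]

lemma ext_X₁_of_ext {S : ShortComplex A} (hS : S.ShortExact) {B : A} {n : ℕ}
    (h₂ : Subsingleton (Abelian.Ext.{w} S.X₂ B n))
    (h₃ : Subsingleton (Abelian.Ext.{w} S.X₃ B (n + 1))) :
    Subsingleton (Abelian.Ext.{w} S.X₁ B n) := by
  refine subsingleton_of_forall_eq 0 fun x => ?_
  obtain ⟨y, rfl⟩ := Abelian.Ext.contravariant_sequence_exact₁ hS B x (n₁ := n + 1)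
    (add_comm _ _) (Subsingleton.elim _ _)
  rw [Subsingleton.elim y 0, Abelian.Ext.comp_zero]

lemma ext_of_retract {M N B : A} (r : Retract M N) {n : ℕ}
    (h : Subsingleton (Abelian.Ext.{w} N B n)) : Subsingleton (Abelian.Ext.{w} M B n) := by
  refine subsingleton_of_forall_eq 0 fun x => ?_
  rw [← Abelian.Ext.mk₀_id_comp x, ← r.retract, ← Abelian.Ext.mk₀_comp_mk₀,
    Abelian.Ext.comp_assoc_of_second_deg_zero, Subsingleton.elim ((Abelian.Ext.mk₀ r.r).comp x _) 0,
    Abelian.Ext.comp_zero]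

lemma ext_of_retract_right {M N B : A} (r : Retract M N) {n : ℕ}
    (h : Subsingleton (Abelian.Ext.{w} B N n)) : Subsingleton (Abelian.Ext.{w} B M n) := by
  refine subsingleton_of_forall_eq 0 fun x => ?_
  rw [← Abelian.Ext.comp_mk₀_id x, ← r.retract, ← Abelian.Ext.mk₀_comp_mk₀,
    ← Abelian.Ext.comp_assoc_of_second_deg_zero,
    Subsingleton.elim (x.comp (Abelian.Ext.mk₀ r.i) _) 0, Abelian.Ext.zero_comp]

lemma exists_lift_of_ext_one {S : ShortComplex A} (hS : S.ShortExact) {B : A}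
    (h : Subsingleton (Abelian.Ext.{w} B S.X₁ 1)) (φ : B ⟶ S.X₃) :
    ∃ ψ : B ⟶ S.X₂, ψ ≫ S.g = φ := by
  obtain ⟨x, hx⟩ := Abelian.Ext.covariant_sequence_exact₃ B hS (Abelian.Ext.mk₀ φ)
    (n₁ := 1) rfl (Subsingleton.elim _ _)
  obtain ⟨ψ, rfl⟩ := (Abelian.Ext.mk₀_bijective _ _).2 x
  refine ⟨ψ, (Abelian.Ext.mk₀_bijective _ _).1 ?_⟩
  rw [← hx, Abelian.Ext.mk₀_comp_mk₀]

lemma ext_right_X₂_of_ext {S : ShortComplex A} (hS : S.ShortExact) {B : A} {n : ℕ}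
    (h₁ : Subsingleton (Abelian.Ext.{w} B S.X₁ n))
    (h₃ : Subsingleton (Abelian.Ext.{w} B S.X₃ n)) :
    Subsingleton (Abelian.Ext.{w} B S.X₂ n) := by
  refine subsingleton_of_forall_eq 0 fun x => ?_
  obtain ⟨y, rfl⟩ := Abelian.Ext.covariant_sequence_exact₂ B hS x (Subsingleton.elim _ _)
  rw [Subsingleton.elim y 0, Abelian.Ext.zero_comp]

namespace ExtOrthogonal

lemma of_projective (P B : A) [Projective P] : ExtOrthogonal.{w} P B :=
  fun n => Abelian.Ext.subsingleton_of_projective P B n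

lemma of_retract {M N B : A} (r : Retract M N) (h : ExtOrthogonal.{w} N B) :
    ExtOrthogonal.{w} M B :=
  fun n => ext_of_retract r (h n)

lemma of_retract_right {M N B : A} (r : Retract M N) (h : ExtOrthogonal.{w} B N) :
    ExtOrthogonal.{w} B M :=
  fun n => ext_of_retract_right r (h n)

lemma of_iso {M N B : A} (e : M ≅ N) (h : ExtOrthogonal.{w} N B) : ExtOrthogonal.{w} M B :=
  h.of_retract (Retract.ofIso e)

lemma X₁ {S : ShortComplex A} (hS : S.ShortExact) {B : A}
    (h₂ : ExtOrthogonal.{w} S.X₂ B) (h₃ : ExtOrthogonal.{w} S.X₃ B) : ExtOrthogonal.{w} S.X₁ B :=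
  fun n => ext_X₁_of_ext hS (h₂ n) (h₃ (n + 1))

lemma X₂ {S : ShortComplex A} (hS : S.ShortExact) {B : A}
    (h₁ : ExtOrthogonal.{w} S.X₁ B) (h₃ : ExtOrthogonal.{w} S.X₃ B) : ExtOrthogonal.{w} S.X₂ B :=
  fun n => ext_X₂_of_ext hS (h₁ n) (h₃ n)

/-- The long exact sequence settles degrees at least 2. In degree 1 the term on the left is Hom(X₁,
B), so vanishing there has to be assumed. -/
lemma X₃ {S : ShortComplex A} (hS : S.ShortExact) {B : A}
    (h₁ : ExtOrthogonal.{w} S.X₁ B) (h₂ : ExtOrthogonal.{w} S.X₂ B)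
    (h : Subsingleton (Abelian.Ext.{w} S.X₃ B 1)) : ExtOrthogonal.{w} S.X₃ B
  | 0 => h
  | n + 1 => ext_X₃_of_ext hS (h₁ n) (h₂ (n + 1))

lemma right_X₂ {S : ShortComplex A} (hS : S.ShortExact) {B : A}
    (h₁ : ExtOrthogonal.{w} B S.X₁) (h₃ : ExtOrthogonal.{w} B S.X₃) : ExtOrthogonal.{w} B S.X₂ :=
  fun n => ext_right_X₂_of_ext hS (h₁ n) (h₃ n)

/-- Dimension shifting along a class of objects closed under suitable syzygies. -/
lemma of_class {B : A} (W : ObjectProperty A)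
    (hW : ∀ X, W X → ∃ (K P : A) (f : K ⟶ P) (g : P ⟶ X) (w : f ≫ g = 0),
      (ShortComplex.mk f g w).ShortExact ∧ ExtOrthogonal.{w} P B ∧ W K ∧
        ∀ φ : K ⟶ B, ∃ ψ : P ⟶ B, f ≫ ψ = φ) {X : A} (hX : W X) : ExtOrthogonal.{w} X B := by
  intro n
  induction n generalizing X with
  | zero =>
    obtain ⟨K, P, f, g, w, hS, hP, -, hf⟩ := hW X hX
    exact ext_one_of_exists_extension hS (hP 0) hf
  | succ n ih =>
    obtain ⟨K, P, f, g, w, hS, hP, hK, -⟩ := hW X hX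
    exact ext_X₃_of_ext hS (ih hK) (hP (n + 1))

end ExtOrthogonal

end ExtVanishing

/-! ### Hom-exactness, syzygies and splicing -/

lemma exists_seq_of_forall_exists {A : Type*} {p : A → Prop} {r : A → A → Prop}
    (h : ∀ M, p M → ∃ L, r M L ∧ p L) {M : A} (hM : p M) :
    ∃ L : ℕ → A, L 0 = M ∧ ∀ n, p (L n) ∧ r (L n) (L (n + 1)) := by
  choose! φ hφ using h
  refine ⟨fun n => φ^[n] M, rfl, fun n => ?_⟩
  have hn : p (φ^[n] M) := by
    induction n with
    | zero => exact hM
    | succ n ih =>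
      rw [Function.iterate_succ_apply']
      exact (hφ _ ih).2
  refine ⟨hn, ?_⟩
  change r (φ^[n] M) (φ^[n + 1] M)
  rw [Function.iterate_succ_apply']
  exact (hφ _ hn).1

section Abelian

universe w

variable {A : Type u} [Category.{v} A] [Abelian A]

lemma homExact_iff (T : ChainComplex A ℤ) (B : A) :
    HomExact T B ↔ ∀ i j k : ℤ, i + 1 = j → j + 1 = k →
      ∀ φ : T.X j ⟶ B, T.d k j ≫ φ = 0 → ∃ ψ : T.X i ⟶ B, T.d j i ≫ ψ = φ := by
  constructor
  · rintro h i j k hij rfl φ hφ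
    obtain rfl : i = j - 1 := by lia
    exact (h j φ).1 hφ
  · intro h n φ
    constructor
    · intro hφ
      exact h (n - 1) n (n + 1) (by lia) rfl φ hφ
    · rintro ⟨ψ, rfl⟩
      simp

/-- If a complex is exact at `j`, the sequence `opcycles j ⟶ X i ⟶ opcycles i` is short exact. -/
lemma shortExact_opcycles {ι : Type*} {c : ComplexShape ι} (T : HomologicalComplex A c)
    {i j : ι} (hij : c.Rel j i) (hT : T.ExactAt j) :
    (ShortComplex.mk (T.fromOpcycles j i) (T.pOpcycles i)
      (by rw [← cancel_epi (T.pOpcycles j)]; simp)).ShortExact := by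
  have hmono : Mono (T.fromOpcycles j i) := by
    obtain rfl := c.next_eq' hij
    have h := (T.sc j).exact_iff_mono_fromOpcycles.1 hT
    have e : T.fromOpcycles j (c.next j) = (T.sc j).fromOpcycles := by
      refine (cancel_epi (T.pOpcycles j)).1 ?_
      exact (T.p_fromOpcycles j (c.next j)).trans (T.sc j).p_fromOpcycles.symm
    rw [e]
    exact h
  have hepi : Epi (T.pOpcycles i) := inferInstance
  refine ShortComplex.ShortExact.mk' ?_ hmono hepi
  let φ : ShortComplex.mk (T.d j i) (T.pOpcycles i) (by simp) ⟶
      ShortComplex.mk (T.fromOpcycles j i) (T.pOpcycles i)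
        (by rw [← cancel_epi (T.pOpcycles j)]; simp) :=
    { τ₁ := T.pOpcycles j, τ₂ := 𝟙 _, τ₃ := 𝟙 _ }
  have : Epi φ.τ₁ := inferInstanceAs (Epi (T.pOpcycles j))
  have : IsIso φ.τ₂ := inferInstanceAs (IsIso (𝟙 _))
  have : Mono φ.τ₃ := inferInstanceAs (Mono (𝟙 _))
  rw [← ShortComplex.exact_iff_of_epi_of_isIso_of_mono φ]
  exact ShortComplex.exact_of_g_is_cokernel _ (T.opcyclesIsCokernel j i (c.prev_eq' hij))

/-- A map T_j → B killing the incoming differential is the same as a map out of the opcycles, so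
Hom-exactness becomes an extension problem along `fromOpcycles`. -/
lemma homExact_iff_exists_extension (T : ChainComplex A ℤ) (B : A) :
    HomExact T B ↔ ∀ i j : ℤ, i + 1 = j → ∀ φ : T.opcycles j ⟶ B,
      ∃ ψ : T.X i ⟶ B, T.fromOpcycles j i ≫ ψ = φ := by
  rw [homExact_iff]
  constructor
  · intro h i j hij φ
    obtain ⟨ψ, hψ⟩ := h i j (j + 1) hij rfl (T.pOpcycles j ≫ φ) (by simp)
    exact ⟨ψ, by rw [← cancel_epi (T.pOpcycles j), ← hψ]; simp⟩
  · intro h i j k hij hjk φ hφ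
    obtain ⟨ψ, hψ⟩ := h i j hij (T.descOpcycles φ k (by simp [← hjk]) hφ)
    exact ⟨ψ, by rw [← T.p_fromOpcycles, Category.assoc, hψ, T.p_descOpcycles]⟩

/-- In an acyclic complex the image of a differential is given by the opcycles. -/
noncomputable def imageIsoOpcycles (T : ChainComplex A ℤ) (hT : T.Acyclic) (i j : ℤ)
    (hij : i + 1 = j) : image (T.d j i) ≅ T.opcycles j :=
  have : Mono (T.fromOpcycles j i) := (shortExact_opcycles T (by simpa) (hT j)).mono_f
  have : StrongEpi (T.pOpcycles j) := strongEpi_of_epi _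
  (image.isoStrongEpiMono (T.pOpcycles j) (T.fromOpcycles j i) (T.p_fromOpcycles j i)).symm

section Splice

variable {O T : ℤ → A} {f : ∀ n, O (n + 1) ⟶ T n} {g : ∀ n, T n ⟶ O n}
  {w : ∀ n, f n ≫ g n = 0}

/-- The complex obtained by splicing sequences `O (n + 1) ⟶ T n ⟶ O n`. -/
noncomputable def spliceComplex (w : ∀ n, f n ≫ g n = 0) : ChainComplex A ℤ :=
  ChainComplex.of T (fun n => g (n + 1) ≫ f n) (by simp [reassoc_of% w])

lemma spliceComplex_d (n : ℤ) : (spliceComplex w).d (n + 1) n = g (n + 1) ≫ f n :=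
  ChainComplex.of_d T (fun n => g (n + 1) ≫ f n) n

/-- Removing the epimorphism from the incoming differential and the monomorphism from the outgoing
one does not affect exactness, and leaves one of the given short exact sequences. -/
lemma spliceComplex_acyclic (hS : ∀ n, (ShortComplex.mk (f n) (g n) (w n)).ShortExact) :
    (spliceComplex w).Acyclic := by
  intro n
  obtain ⟨m, rfl⟩ : ∃ m, n = m + 1 := ⟨n - 1, by lia⟩
  rw [HomologicalComplex.exactAt_iff' _ (m + 1 + 1) (m + 1) m (by simp) (by simp)]
  let S₁ : ShortComplex A := (spliceComplex w).sc' (m + 1 + 1) (m + 1) m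
  let S₂ : ShortComplex A := ShortComplex.mk (f (m + 1)) (g (m + 1) ≫ f m)
    (by simp [reassoc_of% w])
  let S₃ : ShortComplex A := ShortComplex.mk (f (m + 1)) (g (m + 1)) (w (m + 1))
  let φ : S₁ ⟶ S₂ :=
    { τ₁ := g (m + 1 + 1)
      τ₂ := 𝟙 (T (m + 1))
      τ₃ := 𝟙 (T m)
      comm₁₂ := ((Category.comp_id _).trans (spliceComplex_d (w := w) (m + 1))).symm
      comm₂₃ := (Category.id_comp _).trans
        ((Category.comp_id _).trans (spliceComplex_d (w := w) m)).symm }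
  let ψ : S₃ ⟶ S₂ :=
    { τ₁ := 𝟙 _
      τ₂ := 𝟙 _
      τ₃ := f m
      comm₁₂ := by simp [S₂, S₃]
      comm₂₃ := by simp [S₂, S₃] }
  have : Epi φ.τ₁ := (hS (m + 1 + 1)).epi_g
  have : IsIso φ.τ₂ := inferInstanceAs (IsIso (𝟙 (T (m + 1))))
  have : Mono φ.τ₃ := inferInstanceAs (Mono (𝟙 (T m)))
  have : Epi ψ.τ₁ := inferInstanceAs (Epi (𝟙 _))
  have : IsIso ψ.τ₂ := inferInstanceAs (IsIso (𝟙 _))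
  have : Mono ψ.τ₃ := (hS m).mono_f
  exact (ShortComplex.exact_iff_of_epi_of_isIso_of_mono φ).2
    ((ShortComplex.exact_iff_of_epi_of_isIso_of_mono ψ).1 (hS (m + 1)).exact)

lemma spliceComplex_homExact [HasExt.{w} A]
    (hS : ∀ n, (ShortComplex.mk (f n) (g n) (w n)).ShortExact) {B : A}
    (hB : ∀ n, Subsingleton (Abelian.Ext.{w} (O n) B 1)) :
    HomExact (spliceComplex w) B := by
  rw [homExact_iff]
  rintro i _ _ rfl rfl (φ : T (i + 1) ⟶ B) hφ
  rw [spliceComplex_d] at hφ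
  have : Epi (g (i + 1 + 1)) := (hS (i + 1 + 1)).epi_g
  have : Epi (g (i + 1)) := (hS (i + 1)).epi_g
  -- Cancelling the epimorphism shows that a cocycle descends to O (i + 1), from where Ext^1(O i, B)
  -- = 0 extends it along f i.
  have hφ' : f (i + 1) ≫ φ = 0 := by
    rw [← cancel_epi (g (i + 1 + 1)), comp_zero]
    exact (Category.assoc _ _ _).symm.trans hφ
  obtain ⟨ψ, hψ⟩ := exists_extension_of_ext_one (hS i) (hB i) ((hS (i + 1)).exact.desc φ hφ')
  refine ⟨ψ, ?_⟩
  rw [spliceComplex_d]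
  refine (Category.assoc _ _ _).trans ?_
  refine (congrArg (fun t => g (i + 1) ≫ t) hψ).trans ?_
  exact (hS (i + 1)).exact.g_desc φ hφ'

/-- The image of a differential of a spliced complex. -/
noncomputable def spliceComplexImageIso
    (hS : ∀ n, (ShortComplex.mk (f n) (g n) (w n)).ShortExact) (i j : ℤ) (hij : i + 1 = j) :
    image ((spliceComplex w).d j i) ≅ O j := by
  subst hij
  have : Mono (f i) := (hS i).mono_f
  have : Epi (g (i + 1)) := (hS (i + 1)).epi_g
  have : StrongEpi (g (i + 1)) := strongEpi_of_epi _
  exact (image.isoStrongEpiMono (C := A) (X := T (i + 1)) (Y := T i)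
    (f := (spliceComplex w).d (i + 1) i) (g (i + 1)) (f i) (spliceComplex_d i).symm).symm

end Splice

/-! ### Complete resolutions versus orthogonal coresolutions -/

/-- `M` admits a coresolution by objects of `Q` all of whose cosyzygies are left orthogonal
to the class `F`. -/
def HasOrthogonalCoresolution.{w₁, v₁, u₁} {A : Type u₁} [Category.{v₁} A] [Abelian A]
    [HasExt.{w₁} A] (Q F : ObjectProperty A) (M : A) : Prop :=
  ∃ W : ObjectProperty A, W M ∧ ∀ N, W N → (∀ B, F B → ExtOrthogonal.{w₁} N B) ∧
    ∃ (E L : A) (f : N ⟶ E) (g : E ⟶ L) (w : f ≫ g = 0),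
      (ShortComplex.mk f g w).ShortExact ∧ Q E ∧ W L

variable [HasExt.{w} A] {P Q F : ObjectProperty A}

namespace HasOrthogonalCoresolution

lemma extOrthogonal {M : A} (h : HasOrthogonalCoresolution.{w} Q F M) {B : A} (hB : F B) :
    ExtOrthogonal.{w} M B := by
  obtain ⟨W, hM, hW⟩ := h
  exact (hW M hM).1 B hB

lemma exists_shortExact {M : A} (h : HasOrthogonalCoresolution.{w} Q F M) :
    ∃ (E L : A) (f : M ⟶ E) (g : E ⟶ L) (w : f ≫ g = 0),
      (ShortComplex.mk f g w).ShortExact ∧ Q E ∧ HasOrthogonalCoresolution.{w} Q F L := by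
  obtain ⟨W, hM, hW⟩ := h
  obtain ⟨-, E, L, f, g, w, hS, hE, hL⟩ := hW M hM
  exact ⟨E, L, f, g, w, hS, hE, W, hL, hW⟩

/-- Coinduction principle: cosyzygies may leave W once they are known to have a coresolution, since
the union of the two classes is again stable. -/
lemma of_class (W : ObjectProperty A)
    (hW : ∀ N, W N → (∀ B, F B → ExtOrthogonal.{w} N B) ∧
      ∃ (E L : A) (f : N ⟶ E) (g : E ⟶ L) (w : f ≫ g = 0),
        (ShortComplex.mk f g w).ShortExact ∧ Q E ∧ (W L ∨ HasOrthogonalCoresolution.{w} Q F L))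
    {M : A} (hM : W M) : HasOrthogonalCoresolution.{w} Q F M := by
  refine ⟨fun N => W N ∨ HasOrthogonalCoresolution.{w} Q F N, Or.inl hM, ?_⟩
  rintro N (hN | hN)
  · exact hW N hN
  · obtain ⟨E, L, f, g, w, hS, hE, hL⟩ := hN.exists_shortExact
    exact ⟨fun B hB => hN.extOrthogonal hB, E, L, f, g, w, hS, hE, Or.inr hL⟩

lemma of_iso {M N : A} (e : M ≅ N) (h : HasOrthogonalCoresolution.{w} Q F N) :
    HasOrthogonalCoresolution.{w} Q F M := by
  refine of_class (fun X => X = M) ?_ rfl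
  rintro _ rfl
  refine ⟨fun B hB => (h.extOrthogonal hB).of_iso e, ?_⟩
  obtain ⟨E, L, f, g, w, hS, hE, hL⟩ := h.exists_shortExact
  refine ⟨E, L, e.hom ≫ f, g, by simp [w], ?_, hE, Or.inr hL⟩
  exact ShortComplex.shortExact_of_iso
    (ShortComplex.isoMk (S₁ := ShortComplex.mk f g w) e.symm (Iso.refl _) (Iso.refl _)
      (by simp) (by simp)) hS

end HasOrthogonalCoresolution

lemma hasOrthogonalCoresolution_of_hasCompleteResolution
    (hP : ∀ X, P X → Projective X) (hQ : ∀ X B, Q X → F B → ExtOrthogonal.{w} X B) {M : A}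
    (h : HasCompleteResolution P Q F M) : HasOrthogonalCoresolution.{w} Q F M := by
  obtain ⟨T, hT, hTF, hTP, hTQ, ⟨e⟩⟩ := h
  refine HasOrthogonalCoresolution.of_iso (e ≪≫ imageIsoOpcycles T hT (-1) 0 (by simp)) ?_
  have hX (i : ℤ) (B : A) (hB : F B) : ExtOrthogonal.{w} (T.X i) B := by
    rcases le_or_gt 0 i with hi | hi
    · have := hP _ (hTP i hi)
      exact .of_projective _ _
    · exact hQ _ _ (hTQ i hi) hB
  refine HasOrthogonalCoresolution.of_class (fun X => ∃ i ≤ (0 : ℤ), X = T.opcycles i) ?_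
    ⟨0, le_rfl, rfl⟩
  rintro _ ⟨i, hi, rfl⟩
  refine ⟨fun B hB => ?_, T.X (i - 1), T.opcycles (i - 1), T.fromOpcycles i (i - 1),
    T.pOpcycles (i - 1), _, shortExact_opcycles T (by simp) (hT i), hTQ _ (by lia),
    Or.inl ⟨i - 1, by lia, rfl⟩⟩
  -- Dimension shifting moves to ever higher syzygies, so it must run over all indices and not only
  -- i ≤ 0.
  refine ExtOrthogonal.of_class (fun X => ∃ i : ℤ, X = T.opcycles i) ?_ ⟨i, rfl⟩
  rintro _ ⟨i, rfl⟩
  exact ⟨T.opcycles (i + 1), T.X i, T.fromOpcycles (i + 1) i, T.pOpcycles i, _,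
    shortExact_opcycles T (by simp) (hT _), hX i B hB, ⟨_, rfl⟩,
    (homExact_iff_exists_extension T B).1 (hTF B hB) i (i + 1) rfl⟩

lemma hasCompleteResolution_of_hasOrthogonalCoresolution
    (hP : ∀ X, P X → Projective X) (hP' : ∀ X : A, ∃ (Y : A) (p : Y ⟶ X), P Y ∧ Epi p) {M : A}
    (h : HasOrthogonalCoresolution.{w} Q F M) : HasCompleteResolution P Q F M := by
  obtain ⟨L, hL₀, hL⟩ := exists_seq_of_forall_exists
    (p := fun X => ∀ B, F B → ExtOrthogonal.{w} X B)
    (r := fun X K => ∃ (T : A) (f : K ⟶ T) (g : T ⟶ X) (w : f ≫ g = 0),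
      (ShortComplex.mk f g w).ShortExact ∧ P T) (by
      intro X hX
      obtain ⟨T, p, hT, hp⟩ := hP' X
      have := hP T hT
      have hS : (ShortComplex.mk (kernel.ι p) p (kernel.condition p)).ShortExact :=
        { exact := ShortComplex.exact_of_f_is_kernel _ (kernelIsKernel p) }
      exact ⟨kernel p, ⟨T, _, _, _, hS, hT⟩,
        fun B hB => ExtOrthogonal.X₁ hS (.of_projective T B) (hX B hB)⟩)
    (fun B hB => h.extOrthogonal hB)
  obtain ⟨K, hK₀, hK⟩ := exists_seq_of_forall_exists
    (p := fun X => HasOrthogonalCoresolution.{w} Q F X)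
    (r := fun X L => ∃ (T : A) (f : X ⟶ T) (g : T ⟶ L) (w : f ≫ g = 0),
      (ShortComplex.mk f g w).ShortExact ∧ Q T) (by
      intro X hX
      obtain ⟨T, L, f, g, w, hS, hT, hL⟩ := hX.exists_shortExact
      exact ⟨L, ⟨T, f, g, w, hS, hT⟩, hL⟩) h
  -- The syzygies L sit in degrees n ≥ 0 and the cosyzygies K 1, K 2, … in degrees -1, -2, …; L 0 =
  -- K 0 = M is the seam, crossed by the sequence of index -1.
  let O : ℤ → A := fun n => match n with
    | Int.ofNat k => L k
    | Int.negSucc k => K (k + 1)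
  have hO (n : ℤ) (B : A) (hB : F B) : ExtOrthogonal.{w} (O n) B := by
    match n with
    | Int.ofNat k => exact (hL k).1 B hB
    | Int.negSucc k => exact (hK (k + 1)).1.extOrthogonal hB
  have key (n : ℤ) : ∃ (T : A) (f : O (n + 1) ⟶ T) (g : T ⟶ O n) (w : f ≫ g = 0),
      (ShortComplex.mk f g w).ShortExact ∧ (0 ≤ n → P T) ∧ (n < 0 → Q T) := by
    match n with
    | Int.ofNat k =>
      obtain ⟨T, f, g, w, hS, hT⟩ := (hL k).2
      exact ⟨T, f, g, w, hS, fun _ => hT, fun hn => by simp at hn; lia⟩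
    | Int.negSucc 0 =>
      have h₀ := (hK 0).2
      rw [hK₀, ← hL₀] at h₀
      obtain ⟨T, f, g, w, hS, hT⟩ := h₀
      exact ⟨T, f, g, w, hS, fun hn => by simp at hn, fun _ => hT⟩
    | Int.negSucc (k + 1) =>
      obtain ⟨T, f, g, w, hS, hT⟩ := (hK (k + 1)).2
      exact ⟨T, f, g, w, hS, fun hn => by simp at hn, fun _ => hT⟩
  choose T f g w hS hTP hTQ using key
  refine ⟨spliceComplex w, spliceComplex_acyclic hS,
    fun B hB => spliceComplex_homExact hS fun n => hO n B hB 0, hTP, hTQ, ⟨?_⟩⟩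
  exact eqToIso hL₀.symm ≪≫ (show _ ≅ O 0 from spliceComplexImageIso hS (-1) 0 rfl).symm

end Abelian

/-! ### Closure of orthogonal coresolutions under extensions and cokernels -/

section Abelian

universe w

variable {A : Type u} [Category.{v} A] [Abelian A]

/-- If `a : X ⟶ E` is a monomorphism with cokernel `N` which extends along a monomorphism
`X ⟶ Y` with cokernel `L` to `e : Y ⟶ E`, then `Y ⟶ E ⊞ L` is a monomorphism with cokernel `N`. -/
lemma exists_shortExact_biprod {X Y L E N : A} {i : X ⟶ Y} {p : Y ⟶ L} {w : i ≫ p = 0}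
    (hS : (ShortComplex.mk i p w).ShortExact) {a : X ⟶ E} {q : E ⟶ N} {w' : a ≫ q = 0}
    (hS' : (ShortComplex.mk a q w').ShortExact) (e : Y ⟶ E) (he : i ≫ e = a) :
    ∃ (r : E ⊞ L ⟶ N) (w'' : biprod.lift e p ≫ r = 0),
      (ShortComplex.mk (biprod.lift e p) r w'').ShortExact := by
  have : Mono i := hS.mono_f
  have : Epi p := hS.epi_g
  have : Mono a := hS'.mono_f
  have : Epi q := hS'.epi_g
  obtain ⟨r, hr⟩ : ∃ r : L ⟶ N, p ≫ r = e ≫ q :=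
    ⟨hS.exact.desc (e ≫ q) (by simp [reassoc_of% he, w']), hS.exact.g_desc _ _⟩
  have w'' : biprod.lift e p ≫ biprod.desc q (-r) = 0 := by simp [hr]
  refine ⟨biprod.desc q (-r), w'', ShortComplex.ShortExact.mk' ?_ ?_ ?_⟩
  · rw [ShortComplex.exact_iff_exact_up_to_refinements]
    intro T x hx
    dsimp at x hx
    obtain ⟨T', π, hπ, y, hy⟩ := surjective_up_to_refinements_of_epi p (x ≫ biprod.snd)
    have hx' : (x ≫ biprod.fst) ≫ q = (x ≫ biprod.snd) ≫ r := by
      have hx₂ : x ≫ (biprod.fst ≫ q + biprod.snd ≫ (-r)) = 0 := by rw [← biprod.desc_eq, hx]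
      simpa [add_neg_eq_zero] using hx₂
    have h0 : (π ≫ x ≫ biprod.fst - y ≫ e) ≫ q = 0 := by
      rw [Preadditive.sub_comp, Category.assoc, hx', Category.assoc y, ← hr, ← Category.assoc y p r,
        ← hy]
      simp only [Category.assoc, sub_self]
    -- The lift y has the right second coordinate; its error in E dies in N, so it comes from X, and
    -- adding its image in Y corrects the first coordinate without changing the second.
    refine ⟨T', π, hπ, y + hS'.exact.lift _ h0 ≫ i, ?_⟩
    have h1 : hS'.exact.lift _ h0 ≫ a = π ≫ x ≫ biprod.fst - y ≫ e := hS'.exact.lift_f _ _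
    dsimp
    ext
    · simp [he, h1]
    · simp [w, hy]
  · refine Preadditive.mono_of_cancel_zero _ fun {T} x hx => ?_
    dsimp at x hx
    have h₁ : x ≫ e = 0 := by simpa using hx =≫ biprod.fst
    have h₂ : x ≫ p = 0 := by simpa using hx =≫ biprod.snd
    have h₃ : hS.exact.lift x h₂ ≫ i = x := hS.exact.lift_f _ _
    have h₄ : hS.exact.lift x h₂ ≫ a = 0 := by rw [← he, reassoc_of% h₃, h₁]
    rw [← h₃, zero_of_comp_mono _ h₄, zero_comp]
  · exact epi_of_epi_fac (biprod.inl_desc q (-r))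

/-- The short exact sequence of cokernels of a composition of monomorphisms. -/
lemma exists_shortExact_comp {X Y Z N L : A} {f : X ⟶ Y} {p : Y ⟶ N} {w : f ≫ p = 0}
    (hS : (ShortComplex.mk f p w).ShortExact) {g : Y ⟶ Z} {q : Z ⟶ L} {w' : g ≫ q = 0}
    (hS' : (ShortComplex.mk g q w').ShortExact) :
    ∃ (V : A) (π : Z ⟶ V) (w₁ : (f ≫ g) ≫ π = 0) (i : N ⟶ V) (r : V ⟶ L) (w₂ : i ≫ r = 0),
      (ShortComplex.mk (f ≫ g) π w₁).ShortExact ∧ (ShortComplex.mk i r w₂).ShortExact := by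
  have : Mono f := hS.mono_f
  have : Epi p := hS.epi_g
  have : Mono g := hS'.mono_f
  have : Epi q := hS'.epi_g
  have hc : (ShortComplex.mk (f ≫ g) (cokernel.π (f ≫ g)) (cokernel.condition _)).ShortExact :=
    { exact := ShortComplex.exact_of_g_is_cokernel _ (cokernelIsCokernel _)
      mono_f := inferInstanceAs (Mono (f ≫ g))
      epi_g := inferInstanceAs (Epi (cokernel.π (f ≫ g))) }
  obtain ⟨i, hi⟩ : ∃ i : N ⟶ cokernel (f ≫ g), p ≫ i = g ≫ cokernel.π (f ≫ g) :=
    ⟨hS.exact.desc (g ≫ cokernel.π (f ≫ g))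
      (by rw [← Category.assoc, cokernel.condition]), hS.exact.g_desc _ _⟩
  have w₃ : (f ≫ g) ≫ q = 0 := by simp [w']
  have hr : cokernel.π (f ≫ g) ≫ cokernel.desc (f ≫ g) q w₃ = q := by simp
  have w₂ : i ≫ cokernel.desc (f ≫ g) q w₃ = 0 := by
    rw [← cancel_epi p, reassoc_of% hi, hr, w', comp_zero]
  refine ⟨_, _, _, i, cokernel.desc (f ≫ g) q w₃, w₂, hc, ShortComplex.ShortExact.mk' ?_ ?_ ?_⟩
  · rw [ShortComplex.exact_iff_exact_up_to_refinements]
    intro T x hx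
    dsimp at x hx
    obtain ⟨T', π, hπ, y, hy⟩ := surjective_up_to_refinements_of_epi (cokernel.π (f ≫ g)) x
    have h₀ : y ≫ q = 0 := by rw [← hr, ← Category.assoc, ← hy, Category.assoc, hx, comp_zero]
    have h₁ : hS'.exact.lift y h₀ ≫ g = y := hS'.exact.lift_f _ _
    refine ⟨T', π, hπ, hS'.exact.lift y h₀ ≫ p, ?_⟩
    dsimp
    rw [hy, Category.assoc, hi, reassoc_of% h₁]
  · refine Preadditive.mono_of_cancel_zero _ fun {T} x hx => ?_
    dsimp at x hx
    obtain ⟨T', π, hπ, y, hy⟩ := surjective_up_to_refinements_of_epi p x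
    have h₀ : (y ≫ g) ≫ cokernel.π (f ≫ g) = 0 := by
      rw [Category.assoc, ← hi, ← Category.assoc, ← hy, Category.assoc, hx, comp_zero]
    have h₁ : hc.exact.lift (y ≫ g) h₀ ≫ f ≫ g = y ≫ g := hc.exact.lift_f _ _
    have h₂ : hc.exact.lift (y ≫ g) h₀ ≫ f = y := by
      rw [← cancel_mono g, Category.assoc, h₁]
    rw [← cancel_epi π, hy, ← h₂, Category.assoc, w, comp_zero, comp_zero]
  · exact epi_of_epi_fac hr

lemma shortExact_biprod_map {L E N : A} {a : L ⟶ E} {q : E ⟶ N} {w : a ≫ q = 0}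
    (hS : (ShortComplex.mk a q w).ShortExact) (Y : A) :
    (ShortComplex.mk (biprod.map (𝟙 Y) a) (biprod.snd ≫ q) (by simp [w])).ShortExact := by
  have : Mono a := hS.mono_f
  have : Epi q := hS.epi_g
  refine ShortComplex.ShortExact.mk' ?_ (inferInstanceAs (Mono (biprod.map (𝟙 Y) a)))
    (inferInstanceAs (Epi (biprod.snd ≫ q)))
  rw [ShortComplex.exact_iff_exact_up_to_refinements]
  intro T x hx
  dsimp at x hx
  have h₀ : (x ≫ biprod.snd) ≫ q = 0 := by simpa using hx
  have h₁ : hS.exact.lift _ h₀ ≫ a = x ≫ biprod.snd := hS.exact.lift_f _ _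
  refine ⟨T, 𝟙 T, inferInstance, biprod.lift (x ≫ biprod.fst) (hS.exact.lift _ h₀), ?_⟩
  dsimp
  ext <;> simp [h₁]

variable [HasExt.{w} A] {Q F : ObjectProperty A}

namespace HasOrthogonalCoresolution

lemma of_mem (hQ : ∀ X B, Q X → F B → ExtOrthogonal.{w} X B)
    (h₀ : ∀ X : A, IsZero X → Q X) {X : A} (hX : Q X) :
    HasOrthogonalCoresolution.{w} Q F X := by
  refine ⟨Q, hX, fun N hN => ⟨fun B hB => hQ N B hN hB, N, _, 𝟙 N, 0, comp_zero, ?_, hN,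
    h₀ _ (isZero_zero A)⟩⟩
  exact ShortComplex.ShortExact.mk' ((ShortComplex.exact_iff_epi _ rfl).2
    (inferInstanceAs (Epi (𝟙 N)))) (inferInstanceAs (Mono (𝟙 N)))
    ((isZero_zero A).epi _)

/-- Horseshoe argument: as Q ⊆ F, Ext^1(L, E) = 0 extends X → E to Y. Then Y → E ⊞ L → E ⊞ E' has a
cokernel that is an extension of N' by N, so the construction repeats. -/
lemma of_extension (hQF : ∀ X, Q X → F X)
    (hQ : ∀ X Y, Q X → Q Y → Q (X ⊞ Y)) {S : ShortComplex A} (hS : S.ShortExact)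
    (h₁ : HasOrthogonalCoresolution.{w} Q F S.X₁) (h₃ : HasOrthogonalCoresolution.{w} Q F S.X₃) :
    HasOrthogonalCoresolution.{w} Q F S.X₂ := by
  refine of_class (fun Y => ∃ (X L : A) (i : X ⟶ Y) (p : Y ⟶ L) (w : i ≫ p = 0),
    (ShortComplex.mk i p w).ShortExact ∧ HasOrthogonalCoresolution.{w} Q F X ∧
      HasOrthogonalCoresolution.{w} Q F L) ?_ ⟨_, _, S.f, S.g, S.zero, hS, h₁, h₃⟩
  rintro Y ⟨X, L, i, p, w, hS, hX, hL⟩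
  refine ⟨fun B hB => .X₂ hS (hX.extOrthogonal hB) (hL.extOrthogonal hB), ?_⟩
  obtain ⟨E, N, a, q, w', hS', hE, hN⟩ := hX.exists_shortExact
  obtain ⟨E', N', a', q', w'', hS'', hE', hN'⟩ := hL.exists_shortExact
  obtain ⟨e, he⟩ := exists_extension_of_ext_one hS (hL.extOrthogonal (hQF E hE) 0) a
  obtain ⟨r, wr, hr⟩ := exists_shortExact_biprod hS hS' e he
  have hm : (ShortComplex.mk (biprod.map (𝟙 E) a') (biprod.snd ≫ q')
      (by simp [w''])).ShortExact := shortExact_biprod_map hS'' E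
  obtain ⟨V, π, w₁, i', r', w₂, h₁, h₂⟩ := exists_shortExact_comp hr hm
  exact ⟨E ⊞ E', V, _, π, w₁, h₁, hQ _ _ hE hE', Or.inl ⟨N, N', i', r', w₂, h₂, hN, hN'⟩⟩

/-- The third term of a short exact sequence of objects with orthogonal coresolutions
has an orthogonal coresolution as soon as its first extension groups vanish. -/
lemma of_shortExact (hQF : ∀ X, Q X → F X) (hQ : ∀ X B, Q X → F B → ExtOrthogonal.{w} X B)
    (hQ₀ : ∀ X : A, IsZero X → Q X) (hQ₂ : ∀ X Y, Q X → Q Y → Q (X ⊞ Y))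
    {S : ShortComplex A} (hS : S.ShortExact)
    (h₁ : HasOrthogonalCoresolution.{w} Q F S.X₁) (h₂ : HasOrthogonalCoresolution.{w} Q F S.X₂)
    (h : ∀ B, F B → Subsingleton (Abelian.Ext.{w} S.X₃ B 1)) :
    HasOrthogonalCoresolution.{w} Q F S.X₃ := by
  obtain ⟨E, N, a, q, w', hS', hE, hN⟩ := h₁.exists_shortExact
  obtain ⟨e, he⟩ := exists_extension_of_ext_one hS (h E (hQF E hE)) a
  obtain ⟨r, wr, hr⟩ := exists_shortExact_biprod (w := S.zero) hS hS' e he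
  have hU : HasOrthogonalCoresolution.{w} Q F (E ⊞ S.X₃) := of_extension hQF hQ₂ hr h₂ hN
  obtain ⟨E', L, f, g, w'', hS'', hE', hL⟩ := hU.exists_shortExact
  have hi : (ShortComplex.mk (biprod.inr : S.X₃ ⟶ E ⊞ S.X₃) biprod.fst (by simp)).ShortExact :=
    (ShortComplex.Splitting.mk (S := ShortComplex.mk (biprod.inr : S.X₃ ⟶ E ⊞ S.X₃) biprod.fst
      (by simp)) biprod.snd biprod.inl (by simp) (by simp)
      (by rw [add_comm]; exact biprod.total)).shortExact
  -- The cokernel V of the composite X₃ → E ⊞ X₃ → E' is an extension of L by E.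
  obtain ⟨V, π, w₁, i', r', w₂, h₁', h₂'⟩ := exists_shortExact_comp hi hS''
  have hV : HasOrthogonalCoresolution.{w} Q F V :=
    of_extension hQF hQ₂ h₂' (of_mem hQ hQ₀ hE) hL
  refine of_class (fun X => X = S.X₃) ?_ rfl
  rintro _ rfl
  exact ⟨fun B hB => .X₃ hS (h₁.extOrthogonal hB) (h₂.extOrthogonal hB) (h B hB),
    E', V, _, π, w₁, h₁', hE', Or.inr hV⟩

end HasOrthogonalCoresolution

end Abelian

/-! ### Contractible complexes -/

section Abelian

universe w

variable {A : Type u} [Category.{v} A] [Abelian A]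

/-- In an acyclic complex, the sequence `cycles j ⟶ X j ⟶ cycles i` is short exact. -/
lemma shortExact_cycles (T : ChainComplex A ℤ) (hT : T.Acyclic) {i j : ℤ} (hij : i + 1 = j) :
    (ShortComplex.mk (T.iCycles j) (T.toCycles j i)
      (by rw [← cancel_mono (T.iCycles i)]; simp)).ShortExact := by
  have hij' : (ComplexShape.down ℤ).Rel j i := hij
  have hepi : Epi (T.toCycles j i) := by
    obtain rfl := (ComplexShape.down ℤ).prev_eq' hij'
    have h := (T.sc i).exact_iff_epi_toCycles.1 (hT i)
    have e : T.toCycles ((ComplexShape.down ℤ).prev i) i = (T.sc i).toCycles := by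
      refine (cancel_mono (T.iCycles i)).1 ?_
      exact (T.toCycles_i ((ComplexShape.down ℤ).prev i) i).trans (T.sc i).toCycles_i.symm
    rw [e]
    exact h
  have hmono : Mono (T.iCycles j) := inferInstance
  refine ShortComplex.ShortExact.mk' ?_ hmono hepi
  let φ : ShortComplex.mk (T.iCycles j) (T.toCycles j i)
        (by rw [← cancel_mono (T.iCycles i)]; simp) ⟶
      ShortComplex.mk (T.iCycles j) (T.d j i) (by simp) :=
    { τ₁ := 𝟙 _, τ₂ := 𝟙 _, τ₃ := T.iCycles i }
  have : Epi φ.τ₁ := inferInstanceAs (Epi (𝟙 _))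
  have : IsIso φ.τ₂ := inferInstanceAs (IsIso (𝟙 _))
  have : Mono φ.τ₃ := inferInstanceAs (Mono (T.iCycles i))
  rw [ShortComplex.exact_iff_of_epi_of_isIso_of_mono φ]
  exact ShortComplex.exact_of_f_is_kernel _
    (T.cyclesIsKernel j i ((ComplexShape.down ℤ).next_eq' hij'))

/-- The contractible complex with `M i ⊞ M (i - 1)` in degree `i` and cycles `M i`. -/
noncomputable def contractible (M : ℤ → A) : ChainComplex A ℤ where
  X i := M i ⊞ M (i - 1)
  d i j := if h : i - 1 = j then biprod.snd ≫ eqToHom (congrArg M h) ≫ biprod.inl else 0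
  shape i j hij := dif_neg fun h => hij (by simp [← h])
  d_comp_d' i j k hij hjk := by
    obtain rfl : i - 1 = j := by simp at hij; lia
    obtain rfl : i - 1 - 1 = k := by simp at hjk; lia
    simp

namespace contractible

variable (M : ℤ → A)

/-- The projection of the contractible complex in degree `i` on the first summand. -/
noncomputable def fst (i : ℤ) : (contractible M).X i ⟶ M i := (biprod.fst : M i ⊞ M (i - 1) ⟶ _)

/-- The inclusion in the contractible complex in degree `i` of the first summand. -/
noncomputable def inl (i : ℤ) : M i ⟶ (contractible M).X i := (biprod.inl : _ ⟶ M i ⊞ M (i - 1))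

/-- The projection of the contractible complex in degree `i` on the second summand. -/
noncomputable def snd (i : ℤ) : (contractible M).X i ⟶ M (i - 1) :=
  (biprod.snd : M i ⊞ M (i - 1) ⟶ _)

/-- The inclusion in the contractible complex in degree `i` of the second summand. -/
noncomputable def inr (i : ℤ) : M (i - 1) ⟶ (contractible M).X i :=
  (biprod.inr : _ ⟶ M i ⊞ M (i - 1))

@[simp]
lemma inl_fst (i : ℤ) : inl M i ≫ fst M i = 𝟙 _ := biprod.inl_fst

@[simp]
lemma inl_fst_assoc (i : ℤ) {X : A} (h : M i ⟶ X) : inl M i ≫ fst M i ≫ h = h := by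
  rw [← Category.assoc, inl_fst, Category.id_comp]

@[simp]
lemma inl_snd (i : ℤ) : inl M i ≫ snd M i = 0 := biprod.inl_snd

@[simp]
lemma inl_snd_assoc (i : ℤ) {X : A} (h : M (i - 1) ⟶ X) : inl M i ≫ snd M i ≫ h = 0 := by
  rw [← Category.assoc, inl_snd, zero_comp]

@[simp]
lemma inr_fst (i : ℤ) : inr M i ≫ fst M i = 0 := biprod.inr_fst

@[simp]
lemma inr_fst_assoc (i : ℤ) {X : A} (h : M i ⟶ X) : inr M i ≫ fst M i ≫ h = 0 := by
  rw [← Category.assoc, inr_fst, zero_comp]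

@[simp]
lemma inr_snd (i : ℤ) : inr M i ≫ snd M i = 𝟙 _ := biprod.inr_snd

@[simp]
lemma inr_snd_assoc (i : ℤ) {X : A} (h : M (i - 1) ⟶ X) : inr M i ≫ snd M i ≫ h = h := by
  rw [← Category.assoc, inr_snd, Category.id_comp]

lemma total (i : ℤ) : fst M i ≫ inl M i + snd M i ≫ inr M i = 𝟙 _ := biprod.total

lemma d_sub_one (i : ℤ) : (contractible M).d i (i - 1) = snd M i ≫ inl M (i - 1) := by
  simp [contractible, snd, inl]

variable {M}

lemma hom_ext_to {X : A} {i : ℤ} {f g : X ⟶ (contractible M).X i}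
    (h₁ : f ≫ fst M i = g ≫ fst M i) (h₂ : f ≫ snd M i = g ≫ snd M i) : f = g := by
  rw [← Category.comp_id f, ← Category.comp_id g, ← total]
  simp [reassoc_of% h₁, reassoc_of% h₂]

lemma hom_ext_from {X : A} {i : ℤ} {f g : (contractible M).X i ⟶ X}
    (h₁ : inl M i ≫ f = inl M i ≫ g) (h₂ : inr M i ≫ f = inr M i ≫ g) : f = g := by
  rw [← Category.id_comp f, ← Category.id_comp g, ← total]
  simp [h₁, h₂]

lemma d_sub_one_fst (i : ℤ) : (contractible M).d i (i - 1) ≫ fst M (i - 1) = snd M i := by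
  simp [d_sub_one]

lemma inr_d_sub_one (i : ℤ) : inr M i ≫ (contractible M).d i (i - 1) = inl M (i - 1) := by
  simp [d_sub_one]

/-- A family of morphisms `K.X i ⟶ M i` determines a morphism to the contractible complex. -/
noncomputable def lift {K : ChainComplex A ℤ} (φ : ∀ i, K.X i ⟶ M i) : K ⟶ contractible M where
  f i := φ i ≫ inl M i + K.d i (i - 1) ≫ φ (i - 1) ≫ inr M i
  comm' i j hij := by
    obtain rfl : i - 1 = j := by simp at hij; lia
    simp [d_sub_one]

lemma lift_f {K : ChainComplex A ℤ} (φ : ∀ i, K.X i ⟶ M i) (i : ℤ) :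
    (lift φ).f i = φ i ≫ inl M i + K.d i (i - 1) ≫ φ (i - 1) ≫ inr M i := rfl

@[simp]
lemma lift_fst {K : ChainComplex A ℤ} (φ : ∀ i, K.X i ⟶ M i) (i : ℤ) :
    (lift φ).f i ≫ fst M i = φ i := by
  simp [lift_f]

/-- A family of morphisms `M i ⟶ K.X (i + 1)` determines a morphism from the contractible
complex. -/
noncomputable def desc {K : ChainComplex A ℤ} (ψ : ∀ i j, M i ⟶ K.X j) : contractible M ⟶ K where
  f i := fst M i ≫ ψ i (i + 1) ≫ K.d (i + 1) i + snd M i ≫ ψ (i - 1) i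
  comm' i j hij := by
    obtain rfl : i - 1 = j := by simp at hij; lia
    have : ψ (i - 1) (i - 1 + 1) ≫ K.d (i - 1 + 1) (i - 1) = ψ (i - 1) i ≫ K.d i (i - 1) := by
      rw [sub_add_cancel]
    simp [d_sub_one, this]

lemma desc_f {K : ChainComplex A ℤ} (ψ : ∀ i j, M i ⟶ K.X j) (i : ℤ) :
    (desc ψ).f i = fst M i ≫ ψ i (i + 1) ≫ K.d (i + 1) i + snd M i ≫ ψ (i - 1) i := rfl

@[simp]
lemma inr_desc {K : ChainComplex A ℤ} (ψ : ∀ i j, M i ⟶ K.X j) (i : ℤ) :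
    inr M i ≫ (desc ψ).f i = ψ (i - 1) i := by
  simp [desc_f]

/-- The second component is forced by the first, because `snd` is the differential followed by
`fst`. -/
lemma hom_ext {K : ChainComplex A ℤ} {f g : K ⟶ contractible M}
    (h : ∀ i, f.f i ≫ fst M i = g.f i ≫ fst M i) : f = g := by
  ext i
  refine hom_ext_to (h i) ?_
  rw [← d_sub_one_fst, f.comm_assoc, g.comm_assoc, h]

lemma hom_ext' {K : ChainComplex A ℤ} {f g : contractible M ⟶ K}
    (h : ∀ i, inr M i ≫ f.f i = inr M i ≫ g.f i) : f = g := by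
  ext i
  refine hom_ext_from ?_ (h i)
  obtain ⟨i, rfl⟩ : ∃ j, i = j - 1 := ⟨i + 1, by lia⟩
  rw [← inr_d_sub_one, Category.assoc, Category.assoc, ← f.comm, ← g.comm, reassoc_of% (h i)]

/-- A morphism to the contractible complex extends along a monomorphism as soon as its components
do. -/
lemma exists_extension_to {K L : ChainComplex A ℤ} (j : K ⟶ L) (f : K ⟶ contractible M)
    (h : ∀ i (φ : K.X i ⟶ M i), ∃ ψ : L.X i ⟶ M i, j.f i ≫ ψ = φ) :
    ∃ g : L ⟶ contractible M, j ≫ g = f := by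
  choose ψ hψ using fun i => h i (f.f i ≫ fst M i)
  exact ⟨lift ψ, hom_ext fun i => by simp [hψ]⟩

/-- A family of morphisms `M i ⟶ K.X (i + 1)` is the family of components of a morphism. -/
lemma exists_hom_from {K : ChainComplex A ℤ} (ψ : ∀ i, M (i - 1) ⟶ K.X i) :
    ∃ f : contractible M ⟶ K, ∀ i, inr M i ≫ f.f i = ψ i := by
  -- `desc` takes a family over all pairs (i, j) to avoid transports; only the pairs with j = i + 1
  -- enter, and zero fills the rest.
  refine ⟨desc fun i j => if h : j - 1 = i then eqToHom (by rw [h]) ≫ ψ j else 0, fun i => ?_⟩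
  simp

/-- The functoriality of contractible complexes. -/
noncomputable def map {N : ℤ → A} (t : ∀ i, M i ⟶ N i) : contractible M ⟶ contractible N :=
  lift fun i => fst M i ≫ t i

lemma map_snd {N : ℤ → A} (t : ∀ i, M i ⟶ N i) (i : ℤ) :
    (map t).f i ≫ snd N i = snd M i ≫ t (i - 1) := by
  rw [map, lift_f]
  simp [d_sub_one]

@[simp]
lemma map_fst {N : ℤ → A} (t : ∀ i, M i ⟶ N i) (i : ℤ) :
    (map t).f i ≫ fst N i = fst M i ≫ t i := by
  simp [map]

@[simp]
lemma map_fst_assoc {N : ℤ → A} (t : ∀ i, M i ⟶ N i) (i : ℤ) {X : A} (h : N i ⟶ X) :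
    (map t).f i ≫ fst N i ≫ h = fst M i ≫ t i ≫ h := by
  rw [← Category.assoc, map_fst, Category.assoc]

lemma inr_map {N : ℤ → A} (t : ∀ i, M i ⟶ N i) (i : ℤ) :
    inr M i ≫ (map t).f i = t (i - 1) ≫ inr N i := by
  apply hom_ext_to <;> simp [map_snd]

lemma inr_map_assoc {N : ℤ → A} (t : ∀ i, M i ⟶ N i) (i : ℤ) {X : A}
    (h : (contractible N).X i ⟶ X) :
    inr M i ≫ (map t).f i ≫ h = t (i - 1) ≫ inr N i ≫ h := by
  rw [← Category.assoc, inr_map, Category.assoc]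

lemma inl_map {N : ℤ → A} (t : ∀ i, M i ⟶ N i) (i : ℤ) :
    inl M i ≫ (map t).f i = t i ≫ inl N i := by
  apply hom_ext_to <;> simp [map_snd]

lemma inl_map_assoc {N : ℤ → A} (t : ∀ i, M i ⟶ N i) (i : ℤ) {X : A}
    (h : (contractible N).X i ⟶ X) :
    inl M i ≫ (map t).f i ≫ h = t i ≫ inl N i ≫ h := by
  rw [← Category.assoc, inl_map, Category.assoc]

lemma shortExact_map {K P N : ℤ → A} {f : ∀ i, K i ⟶ P i} {g : ∀ i, P i ⟶ N i}
    {w : ∀ i, f i ≫ g i = 0} (hS : ∀ i, (ShortComplex.mk (f i) (g i) (w i)).ShortExact) :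
    (ShortComplex.mk (map f) (map g) (hom_ext fun i => by simp [w])).ShortExact := by
  apply HomologicalComplex.shortExact_of_degreewise_shortExact
  intro i
  have (i : ℤ) : Mono (f i) := (hS i).mono_f
  have (i : ℤ) : Epi (g i) := (hS i).epi_g
  refine ShortComplex.ShortExact.mk' ?_ ?_ ?_
  · rw [ShortComplex.exact_iff_exact_up_to_refinements]
    intro X (x : X ⟶ (contractible P).X i) (hx : x ≫ (map g).f i = 0)
    have h₁ : (x ≫ fst P i) ≫ g i = 0 := by
      rw [Category.assoc, ← map_fst, reassoc_of% hx, zero_comp]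
    have h₂ : (x ≫ snd P i) ≫ g (i - 1) = 0 := by
      rw [Category.assoc, ← map_snd, reassoc_of% hx, zero_comp]
    refine ⟨X, 𝟙 X, inferInstance, (hS i).exact.lift _ h₁ ≫ inl K i +
      (hS (i - 1)).exact.lift _ h₂ ≫ inr K i, ?_⟩
    have h₁' : (hS i).exact.lift _ h₁ ≫ f i = x ≫ fst P i := (hS i).exact.lift_f _ _
    have h₂' : (hS (i - 1)).exact.lift _ h₂ ≫ f (i - 1) = x ≫ snd P i :=
      (hS (i - 1)).exact.lift_f _ _
    change 𝟙 X ≫ x = _ ≫ (map f).f i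
    apply hom_ext_to
    · simp [h₁']
    · simp [h₂', map_snd]
  · have key (X : A) (x : X ⟶ (contractible K).X i) (hx : x ≫ (map f).f i = 0) : x = 0 := by
      apply hom_ext_to
      · rw [← cancel_mono (f i), Category.assoc, ← map_fst, reassoc_of% hx]
        simp
      · rw [← cancel_mono (f (i - 1)), Category.assoc, ← map_snd, reassoc_of% hx]
        simp
    exact Preadditive.mono_of_cancel_zero _ fun {X} x hx => key X x hx
  · have key (X : A) (x : (contractible N).X i ⟶ X) (hx : (map g).f i ≫ x = 0) : x = 0 := by
      apply hom_ext_from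
      · rw [← cancel_epi (g i), ← inl_map_assoc, hx]
        simp
      · rw [← cancel_epi (g (i - 1)), ← inr_map_assoc, hx]
        simp
    exact Preadditive.epi_of_cancel_zero _ fun {X} x hx => key X x hx

/-- The cycles of the contractible complex. -/
noncomputable def cyclesIso (M : ℤ → A) (i : ℤ) : (contractible M).cycles i ≅ M i := by
  refine IsLimit.conePointUniqueUpToIso ((contractible M).cyclesIsKernel i (i - 1) (by simp))
    (KernelFork.IsLimit.ofι (inl M i) (by simp [d_sub_one]) (fun k _ => k ≫ fst M i) ?_ ?_)
  · intro X k hk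
    have hk' : k ≫ snd M i = 0 := by rw [← d_sub_one_fst, reassoc_of% hk, zero_comp]
    exact hom_ext_to (by simp) (by simp [hk'])
  · rintro X k hk m rfl
    simp

variable (M) in
lemma acyclic : (contractible M).Acyclic := by
  intro i
  obtain ⟨i, rfl⟩ : ∃ j, i = j - 1 := ⟨i + 1, by lia⟩
  rw [HomologicalComplex.exactAt_iff' _ i (i - 1) (i - 1 - 1) (by simp) (by simp),
    ShortComplex.exact_iff_exact_up_to_refinements]
  intro X (x : X ⟶ (contractible M).X (i - 1))
    (hx : x ≫ (contractible M).d (i - 1) (i - 1 - 1) = 0)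
  have hx' : x ≫ snd M (i - 1) = 0 := by rw [← d_sub_one_fst, reassoc_of% hx, zero_comp]
  have key : x = (x ≫ fst M (i - 1) ≫ inr M i) ≫ (contractible M).d i (i - 1) := by
    apply hom_ext_to
    · simp [d_sub_one]
    · simp [d_sub_one, hx']
  exact ⟨X, 𝟙 X, inferInstance, _, (Category.id_comp _).trans key⟩

lemma mem_tildeClass {𝒳 : ObjectProperty A} [𝒳.IsClosedUnderIsomorphisms] (hM : ∀ i, 𝒳 (M i)) :
    tildeClass 𝒳 (contractible M) :=
  ⟨acyclic M, fun i => 𝒳.prop_of_iso (cyclesIso M i).symm (hM i)⟩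

lemma projective (hM : ∀ i, Projective (M i)) : Projective (contractible M) where
  factors {E X} f e he := by
    have (i : ℤ) : Epi (e.f i) := inferInstance
    obtain ⟨g, hg⟩ := exists_hom_from fun i => Projective.factorThru (inr M i ≫ f.f i) (e.f i)
    exact ⟨g, hom_ext' fun i => by simp [reassoc_of% (hg i)]⟩

end contractible

/-- An acyclic complex whose short exact sequences of cycles split is a retract of the
contractible complex on its cycles. -/
lemma nonempty_retract_contractible (K : ChainComplex A ℤ) (hK : K.Acyclic)
    (h : ∀ i j, i + 1 = j → ∃ s : K.cycles i ⟶ K.X j, s ≫ K.toCycles j i = 𝟙 _) :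
    Nonempty (Retract K (contractible fun i => K.cycles i)) := by
  have hs (i : ℤ) : ∃ s : K.cycles (i - 1) ⟶ K.X i, s ≫ K.toCycles i (i - 1) = 𝟙 _ :=
    h (i - 1) i (by lia)
  choose s hs using hs
  have hr (i : ℤ) : ∃ r : K.X i ⟶ K.cycles i,
      r ≫ K.iCycles i + K.toCycles i (i - 1) ≫ s i = 𝟙 _ := by
    have hS := shortExact_cycles K hK (i := i - 1) (j := i) (by lia)
    have h₀ : (𝟙 _ - K.toCycles i (i - 1) ≫ s i) ≫ K.toCycles i (i - 1) = 0 := by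
      simp [hs]
    refine ⟨hS.exact.lift _ h₀, ?_⟩
    have := hS.exact.lift_f _ h₀
    dsimp at this
    rw [this, sub_add_cancel]
  choose r hr using hr
  -- The sections s assemble into a chain map out of the contractible complex, and the retractions r
  -- into one into it; r and s split the cycle sequences, so the composite on K is the identity.
  obtain ⟨q, hq⟩ := contractible.exists_hom_from (M := fun i => K.cycles i) s
  refine ⟨⟨contractible.lift (M := fun i => K.cycles i) r, q, ?_⟩⟩
  ext i
  have hl : contractible.inl (fun i => K.cycles i) i ≫ q.f i = K.iCycles i := by
    obtain ⟨i, rfl⟩ : ∃ j, i = j - 1 := ⟨i + 1, by lia⟩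
    rw [← contractible.inr_d_sub_one, Category.assoc, ← q.comm, reassoc_of% (hq i),
      ← K.toCycles_i, reassoc_of% (hs i)]
  have hd : K.d i (i - 1) ≫ r (i - 1) = K.toCycles i (i - 1) := by
    have h₁ : K.iCycles (i - 1) ≫ r (i - 1) = 𝟙 _ := by
      rw [← cancel_mono (K.iCycles (i - 1)), Category.assoc,
        eq_sub_of_add_eq (hr (i - 1))]
      have : K.iCycles (i - 1) ≫ K.toCycles (i - 1) (i - 1 - 1) = 0 := by
        rw [← cancel_mono (K.iCycles _)]; simp
      simp [reassoc_of% this]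
    rw [← K.toCycles_i, Category.assoc, h₁, Category.comp_id]
  simp [contractible.lift_f, hl, hq, reassoc_of% hd, hr]

variable [HasExt.{w} A] [HasExt.{w} (ChainComplex A ℤ)]

/-- Projective covers of the M i give a projective contractible complex whose kernel is the
contractible complex on the syzygies. Maps from these to H are families from degree i - 1 to H.X i,
so they extend by Ext^1(M (i - 1), H.X i) = 0. -/
lemma ExtOrthogonal.contractible_left [EnoughProjectives A] (H : ChainComplex A ℤ) {M : ℤ → A}
    (hM : ∀ i, ExtOrthogonal.{w} (M (i - 1)) (H.X i)) :
    ExtOrthogonal.{w} (contractible M) H := by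
  refine ExtOrthogonal.of_class (fun X => ∃ M : ℤ → A, X = contractible M ∧
    ∀ i, ExtOrthogonal.{w} (M (i - 1)) (H.X i)) ?_ ⟨M, rfl, hM⟩
  rintro _ ⟨M, rfl, hM⟩
  have hS (i : ℤ) : (ShortComplex.mk (kernel.ι (Projective.π (M i))) (Projective.π (M i))
      (kernel.condition _)).ShortExact :=
    { exact := ShortComplex.exact_of_f_is_kernel _ (kernelIsKernel _) }
  have : Projective (contractible fun i => Projective.over (M i)) :=
    contractible.projective fun i => inferInstance
  refine ⟨_, _, _, _, _, contractible.shortExact_map hS, .of_projective _ _,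
    ⟨_, rfl, fun i => .X₁ (hS (i - 1)) (.of_projective _ _) (hM i)⟩, fun φ => ?_⟩
  have hψ (i : ℤ) := exists_extension_of_ext_one (hS (i - 1)) (hM i 0)
    (contractible.inr (fun i => kernel (Projective.π (M i))) i ≫ φ.f i)
  choose ψ hψ using hψ
  obtain ⟨g, hg⟩ := contractible.exists_hom_from (M := fun i => Projective.over (M i)) ψ
  refine ⟨g, contractible.hom_ext' fun i => ?_⟩
  rw [HomologicalComplex.comp_f, contractible.inr_map_assoc, hg, hψ]

end Abelian

/-! ### Shifts, evaluation in a degree, and degreewise Ext-vanishing -/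

section Abelian

universe w

variable {A : Type u} [Category.{v} A] [Abelian A]

/-- The shift of a chain complex, with `H.X (i + 1)` in degree `i`. -/
@[simps]
def shiftComplex (H : ChainComplex A ℤ) : ChainComplex A ℤ where
  X i := H.X (i + 1)
  d i j := -H.d (i + 1) (j + 1)
  shape i j hij := by
    rw [H.shape, neg_zero]
    intro h
    apply hij
    simp at h ⊢
    lia

/-- The short complexes of a shifted complex. -/
def shiftComplexScIso (H : ChainComplex A ℤ) (i j k : ℤ) :
    (shiftComplex H).sc' i j k ≅ H.sc' (i + 1) (j + 1) (k + 1) :=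
  let e (n : ℤ) : H.X n ≅ H.X n := { hom := -𝟙 _, inv := -𝟙 _ }
  ShortComplex.isoMk (e (i + 1)) (Iso.refl (H.X (j + 1))) (e (k + 1))
    (by
      change (-𝟙 (H.X (i + 1))) ≫ H.d (i + 1) (j + 1) = (-H.d (i + 1) (j + 1)) ≫ 𝟙 (H.X (j + 1))
      simp)
    (by
      change 𝟙 (H.X (j + 1)) ≫ H.d (j + 1) (k + 1) = (-H.d (j + 1) (k + 1)) ≫ (-𝟙 (H.X (k + 1)))
      simp)

lemma tildeClass_shiftComplex {𝒳 : ObjectProperty A} [𝒳.IsClosedUnderIsomorphisms]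
    {H : ChainComplex A ℤ} (hH : tildeClass 𝒳 H) : tildeClass 𝒳 (shiftComplex H) := by
  constructor
  · intro i
    rw [HomologicalComplex.exactAt_iff' _ (i + 1) i (i - 1) (by simp) (by simp)]
    exact ShortComplex.exact_of_iso (shiftComplexScIso H _ _ _).symm
      ((HomologicalComplex.exactAt_iff' _ _ _ _ (by simp) (by simp)).1 (hH.1 (i + 1)))
  · intro i
    exact 𝒳.prop_of_iso (H.cyclesIsoSc' (i + 1 + 1) (i + 1) (i - 1 + 1) (by simp) (by simp) ≪≫
      (ShortComplex.cyclesMapIso (shiftComplexScIso H (i + 1) i (i - 1))).symm ≪≫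
      ((shiftComplex H).cyclesIsoSc' (i + 1) i (i - 1) (by simp) (by simp)).symm) (hH.2 (i + 1))

/-- If `K` is a shift of `H` (with the opposite differential), then `H` is the quotient of the
contractible complex on the terms of `K` by `K`. -/
lemma exists_shortExact_of_shift {H K : ChainComplex A ℤ} (τ : ∀ i, K.X (i - 1) ≅ H.X i)
    (hτ : ∀ i, (τ i).hom ≫ H.d i (i - 1) = -K.d (i - 1) (i - 1 - 1) ≫ (τ (i - 1)).hom) :
    ∃ (f : K ⟶ contractible K.X) (g : contractible K.X ⟶ H) (w : f ≫ g = 0),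
      (ShortComplex.mk f g w).ShortExact := by
  obtain ⟨q, hq⟩ := contractible.exists_hom_from (M := K.X) (K := H) fun i => (τ i).hom
  have hl (i : ℤ) : contractible.inl K.X i ≫ q.f i = -K.d i (i - 1) ≫ (τ i).hom := by
    obtain ⟨i, rfl⟩ : ∃ j, i = j - 1 := ⟨i + 1, by lia⟩
    rw [← contractible.inr_d_sub_one, Category.assoc, ← q.comm, reassoc_of% (hq i), hτ]
  let f : K ⟶ contractible K.X := contractible.lift fun i => 𝟙 (K.X i)
  have hf (i : ℤ) : f.f i = contractible.inl K.X i + K.d i (i - 1) ≫ contractible.inr K.X i := by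
    simp [f, contractible.lift_f]
  -- The sign in `hτ` makes the contributions of the two summands cancel.
  have hfq (i : ℤ) : f.f i ≫ q.f i = 0 := by
    simp [hf, hl, hq]
  refine ⟨f, q, by ext i; exact hfq i, ?_⟩
  apply HomologicalComplex.shortExact_of_degreewise_shortExact
  intro i
  let σ : (ShortComplex.mk (f.f i) (q.f i) (hfq i)).Splitting :=
    { r := contractible.fst K.X i
      s := (τ i).inv ≫ contractible.inr K.X i
      f_r := by simp [hf]
      s_g := by simp [hq]
      id := by
        apply contractible.hom_ext_from
        · simp [hf, reassoc_of% (hl i)]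
        · simp [reassoc_of% (hq i)] }
  exact σ.shortExact

lemma exists_shortExact_shiftComplex (H : ChainComplex A ℤ) :
    ∃ (f : shiftComplex H ⟶ contractible (shiftComplex H).X)
      (g : contractible (shiftComplex H).X ⟶ H) (w : f ≫ g = 0),
      (ShortComplex.mk f g w).ShortExact := by
  have e (i : ℤ) : H.X (i - 1 + 1) = H.X i := by rw [sub_add_cancel]
  refine exists_shortExact_of_shift (fun i => eqToIso (e i)) fun i => ?_
  change eqToHom (e i) ≫ H.d i (i - 1) = -(-H.d (i - 1 + 1) (i - 1 - 1 + 1)) ≫ eqToHom (e (i - 1))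
  rw [Preadditive.neg_comp, neg_neg, H.eqToHom_comp_d (by simp) (by simp),
    H.d_comp_eqToHom (by simp) (by simp)]

lemma tildeClass_of_isZero {𝒳 : ObjectProperty A} (h : ∀ X, IsZero X → 𝒳 X)
    {K : ChainComplex A ℤ} (hK : IsZero K) : tildeClass 𝒳 K := by
  constructor
  · intro i
    rw [HomologicalComplex.exactAt_iff_isZero_homology]
    exact (HomologicalComplex.homologyFunctor A _ i).map_isZero hK
  · intro i
    exact h _ ((HomologicalComplex.cyclesFunctor A _ i).map_isZero hK)

instance (i : ℤ) : (HomologicalComplex.cyclesFunctor A (ComplexShape.down ℤ) i).Additive where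
  map_add {_ _ f g} := ShortComplex.cyclesMap_add
    ((HomologicalComplex.shortComplexFunctor A _ i).map f)
    ((HomologicalComplex.shortComplexFunctor A _ i).map g)

lemma tildeClass_biprod {𝒳 : ObjectProperty A} [𝒳.IsClosedUnderIsomorphisms]
    (h : ∀ X Y, 𝒳 X → 𝒳 Y → 𝒳 (X ⊞ Y)) {K L : ChainComplex A ℤ}
    (hK : tildeClass 𝒳 K) (hL : tildeClass 𝒳 L) : tildeClass 𝒳 (K ⊞ L) := by
  constructor
  · exact (ShortComplex.Splitting.ofHasBinaryBiproduct K L).shortExact.acyclic_X₂ hK.1 hL.1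
  · intro i
    have : PreservesBinaryBiproduct K L
        (HomologicalComplex.cyclesFunctor A (ComplexShape.down ℤ) i) :=
      preservesBinaryBiproduct_of_preservesBiproduct _ _ _
    exact 𝒳.prop_of_iso
      ((HomologicalComplex.cyclesFunctor A (ComplexShape.down ℤ) i).mapBiprod K L).symm
      (h _ _ (hK.2 i) (hL.2 i))

/-- The degreewise evaluation of a complex of complexes. -/
noncomputable def evalComplex (T : ChainComplex (ChainComplex A ℤ) ℤ) (j : ℤ) :
    ChainComplex A ℤ :=
  ((HomologicalComplex.eval A (ComplexShape.down ℤ) j).mapHomologicalComplex _).obj T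

lemma evalComplex_acyclic {T : ChainComplex (ChainComplex A ℤ) ℤ} (hT : T.Acyclic) (j : ℤ) :
    (evalComplex T j).Acyclic :=
  fun n => (hT n).map (HomologicalComplex.eval A (ComplexShape.down ℤ) j)

/-- A cocycle in degree j, extended by zero to the other degrees, is a map of complexes into the
contractible complex on B; Hom-exactness there is then read off in degree j. -/
lemma evalComplex_homExact {T : ChainComplex (ChainComplex A ℤ) ℤ} {B : A}
    (hT : HomExact T (contractible fun _ => B)) (j : ℤ) : HomExact (evalComplex T j) B := by
  rw [homExact_iff] at hT ⊢
  intro a b c hab hbc (φ : (T.X b).X j ⟶ B) (hφ : (T.d c b).f j ≫ φ = 0)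
  classical
  let φ' (i : ℤ) : (T.X b).X i ⟶ B := if h : i = j then eqToHom (by rw [h]) ≫ φ else 0
  obtain ⟨ψ, hψ⟩ := hT a b c hab hbc (contractible.lift φ') (contractible.hom_ext fun i => by
    by_cases h : i = j
    · subst h
      simp [φ', hφ]
    · simp [φ', h])
  refine ⟨ψ.f j ≫ contractible.fst _ j, ?_⟩
  change (T.d b a).f j ≫ ψ.f j ≫ contractible.fst _ j = φ
  rw [← HomologicalComplex.comp_f_assoc, hψ, contractible.lift_fst]
  simp [φ']

/-- Evaluation of a complete resolution in a fixed degree. -/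
lemma hasCompleteResolution_X {P Q F : ObjectProperty (ChainComplex A ℤ)}
    {P' Q' F' : ObjectProperty A} (j : ℤ) (hP : ∀ K, P K → P' (K.X j)) (hQ : ∀ K, Q K → Q' (K.X j))
    (hF : ∀ B, F' B → F (contractible fun _ => B)) {K : ChainComplex A ℤ}
    (hK : HasCompleteResolution P Q F K) : HasCompleteResolution P' Q' F' (K.X j) := by
  obtain ⟨T, hT, hTF, hTP, hTQ, ⟨e⟩⟩ := hK
  refine ⟨evalComplex T j, evalComplex_acyclic hT j,
    fun B hB => evalComplex_homExact (hTF _ (hF B hB)) j, fun i hi => hP _ (hTP i hi),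
    fun i hi => hQ _ (hTQ i hi), ⟨?_⟩⟩
  let E := HomologicalComplex.eval A (ComplexShape.down ℤ) j
  exact E.mapIso e ≪≫ (PreservesImage.iso E (T.d 0 (-1))).symm

variable [HasExt.{w} A] [HasExt.{w} (ChainComplex A ℤ)]

/-- Maps S.X₁ → H are lifted to a contractible complex covering H with kernel the shift of H, where
extension along S.X₁ → S.X₂ is a problem in each degree separately. -/
lemma ext_one_of_degreewise {S : ShortComplex (ChainComplex A ℤ)} (hS : S.ShortExact)
    {H : ChainComplex A ℤ}
    (h₁ : Subsingleton (Abelian.Ext.{w} S.X₁ (shiftComplex H) 1))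
    (h₂ : Subsingleton (Abelian.Ext.{w} S.X₂ H 1))
    (h₃ : ∀ i, Subsingleton (Abelian.Ext.{w} (S.X₃.X i) (H.X (i + 1)) 1)) :
    Subsingleton (Abelian.Ext.{w} S.X₃ H 1) := by
  refine ext_one_of_exists_extension hS h₂ fun φ => ?_
  obtain ⟨f, g, w, hH⟩ := exists_shortExact_shiftComplex H
  obtain ⟨φ', hφ'⟩ := exists_lift_of_ext_one hH h₁ φ
  have hS' (i : ℤ) : (S.map (HomologicalComplex.eval A _ i)).ShortExact :=
    hS.map_of_exact _
  obtain ⟨ψ, hψ⟩ := contractible.exists_extension_to S.f φ'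
    fun i t => exists_extension_of_ext_one (hS' i) (h₃ i) t
  exact ⟨ψ ≫ g, by rw [reassoc_of% hψ]; exact hφ'⟩

end Abelian

/-! ### Ext-orthogonality and tensor products -/

section Modules

open TensorProduct

variable {R : Type u} [CommRing R]

/-- Orthogonality is preserved by tensoring the first module with a projective module. -/
lemma ExtOrthogonal.tensor_projective {N B : ModuleCat.{u} R} (h : ExtOrthogonal.{u} N B)
    (P : Type u) [AddCommGroup P] [Module R P] [Module.Projective R P] :
    ExtOrthogonal.{u} (ModuleCat.of R (N ⊗[R] P)) B := by
  refine ExtOrthogonal.of_class (fun X => ∃ N : ModuleCat.{u} R, X = ModuleCat.of R (N ⊗[R] P) ∧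
    ExtOrthogonal.{u} N B) ?_ ⟨N, rfl, h⟩
  rintro _ ⟨N, rfl, h⟩
  let T := Projective.over N
  let K := kernel (Projective.π N)
  have hS : (ShortComplex.mk (kernel.ι (Projective.π N)) (Projective.π N)
      (kernel.condition _)).ShortExact :=
    { exact := ShortComplex.exact_of_f_is_kernel _ (kernelIsKernel _) }
  have hT : Module.Projective R T := ModuleCat.projective_of_module_projective T
  let f : K →ₗ[R] T := (kernel.ι (Projective.π N)).hom
  let g : T →ₗ[R] N := (Projective.π N).hom
  have hf : Function.Injective f := hS.moduleCat_injective_f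
  have hg : Function.Surjective g := hS.moduleCat_surjective_g
  have hfg : Function.Exact f g := (ShortComplex.ShortExact.moduleCat_exact_iff_function_exact _).1
    hS.exact
  have hfg' : g ∘ₗ f = 0 := hfg.linearMap_comp_eq_zero
  have hS' : (ShortComplex.mk (ModuleCat.ofHom (f.rTensor P)) (ModuleCat.ofHom (g.rTensor P))
      (by rw [← ModuleCat.ofHom_comp, ← LinearMap.rTensor_comp, hfg']; simp)).ShortExact :=
    ModuleCat.shortComplex_shortExact _ (rTensor_exact P hfg hg)
      (Module.Flat.rTensor_preserves_injective_linearMap f hf) (LinearMap.rTensor_surjective P hg)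
  have hTP : Projective (ModuleCat.of R (T ⊗[R] P)) :=
    ModuleCat.projective_of_categoryTheory_projective _
  refine ⟨_, _, _, _, _, hS', .of_projective _ _, ⟨K, rfl, ?_⟩, fun φ => ?_⟩
  · exact ExtOrthogonal.X₁ hS (.of_projective _ _) h
  · have hsurj : Function.Surjective (LinearMap.lcomp R B f) := by
      intro t
      obtain ⟨s, hs⟩ := exists_extension_of_ext_one hS (h 0) (ModuleCat.ofHom t)
      exact ⟨s.hom, ModuleCat.hom_ext_iff.1 hs⟩
    obtain ⟨s, hs⟩ := Module.projective_lifting_property (LinearMap.lcomp R B f)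
      (TensorProduct.curry φ.hom).flip hsurj
    refine ⟨ModuleCat.ofHom (TensorProduct.lift s.flip), ?_⟩
    ext : 1
    refine TensorProduct.ext' fun k p => ?_
    exact LinearMap.congr_fun (LinearMap.congr_fun hs p) k

lemma rTensorHomToHomRTensor_comp {M M' B F : Type*} [AddCommGroup M] [Module R M]
    [AddCommGroup M'] [Module R M'] [AddCommGroup B] [Module R B] [AddCommGroup F] [Module R F]
    (g : M' →ₗ[R] M) (t : (M →ₗ[R] B) ⊗[R] F) :
    rTensorHomToHomRTensor (.id R) M B F t ∘ₗ g =
      rTensorHomToHomRTensor (.id R) M' B F ((LinearMap.lcomp R B g).rTensor F t) := by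
  induction t with
  | zero => simp
  | tmul x y => ext m; simp
  | add x y hx hy => simp [LinearMap.add_comp, hx, hy]

lemma rTensorHomToHomRTensor_bijective (M B F : Type*) [AddCommGroup M] [Module R M]
    [Module.Projective R M] [Module.Finite R M]
    [AddCommGroup B] [Module R B] [AddCommGroup F] [Module R F] :
    Function.Bijective (rTensorHomToHomRTensor (.id R) M B F) := by
  rw [← rTensorHomEquivHomRTensor_toLinearMap]
  exact (rTensorHomEquivHomRTensor R M B F).bijective

lemma extOrthogonal_opcycles {N B : ModuleCat.{u} R} (h : ExtOrthogonal.{u} N B)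
    (P : ProjectiveResolution N) (k : ℕ) : ExtOrthogonal.{u} (P.complex.opcycles k) B := by
  induction k with
  | zero =>
    exact h.of_iso (IsColimit.coconePointUniqueUpToIso
      (P.complex.opcyclesIsCokernel 1 0 (by simp)) P.isColimitCokernelCofork)
  | succ k ih =>
    exact ExtOrthogonal.X₁ (shortExact_opcycles P.complex (i := k) (j := k + 1) (by simp)
      (P.complex_exactAt_succ k)) (.of_projective _ _) ih

/-- If `N` has a resolution by finitely generated projective modules, orthogonality is preserved
by tensoring the second module with a flat module. -/
lemma ExtOrthogonal.tensor_flat {N B : ModuleCat.{u} R} (h : ExtOrthogonal.{u} N B)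
    (P : ProjectiveResolution N) (hP : ∀ n, Module.Finite R (P.complex.X n))
    (F : Type u) [AddCommGroup F] [Module R F] [Module.Flat R F] :
    ExtOrthogonal.{u} N (ModuleCat.of R (B ⊗[R] F)) := by
  have hP' (n : ℕ) : Module.Projective R (P.complex.X n) :=
    ModuleCat.projective_of_module_projective _
  refine ExtOrthogonal.of_iso (IsColimit.coconePointUniqueUpToIso
      (P.complex.opcyclesIsCokernel 1 0 (by simp)) P.isColimitCokernelCofork).symm ?_
  refine ExtOrthogonal.of_class (fun X => ∃ k, X = P.complex.opcycles k) ?_ ⟨0, rfl⟩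
  rintro _ ⟨k, rfl⟩
  have hS := shortExact_opcycles P.complex (i := k) (j := k + 1) (by simp)
    (P.complex_exactAt_succ k)
  refine ⟨_, _, _, _, _, hS, .of_projective _ _, ⟨k + 1, rfl⟩, fun φ => ?_⟩
  let d₁ : P.complex.X (k + 1) →ₗ[R] P.complex.X k := (P.complex.d (k + 1) k).hom
  let d₂ : P.complex.X (k + 2) →ₗ[R] P.complex.X (k + 1) := (P.complex.d (k + 2) (k + 1)).hom
  -- Hom(-, B) of the resolution is exact here since the syzygies of N are orthogonal to B. Flatness
  -- preserves this under ⊗ F, and finite generation identifies Hom(P_n, B) ⊗ F with Hom(P_n, B ⊗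
  -- F).
  have hex : Function.Exact (LinearMap.lcomp R B d₁) (LinearMap.lcomp R B d₂) := by
    intro t
    constructor
    · intro ht
      have ht' : P.complex.d (k + 2) (k + 1) ≫ ModuleCat.ofHom t = 0 := ModuleCat.hom_ext ht
      obtain ⟨s, hs⟩ := exists_extension_of_ext_one hS (extOrthogonal_opcycles h P k 0)
        (P.complex.descOpcycles (ModuleCat.ofHom t) (k + 2) (by simp) ht')
      refine ⟨s.hom, ?_⟩
      have : P.complex.d (k + 1) k ≫ s = ModuleCat.ofHom t := by
        rw [← P.complex.p_fromOpcycles, Category.assoc]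
        exact (congrArg (fun x => P.complex.pOpcycles (k + 1) ≫ x) hs).trans
          (P.complex.p_descOpcycles _ _ _ _)
      exact ModuleCat.hom_ext_iff.1 this
    · rintro ⟨s, rfl⟩
      have : P.complex.d (k + 2) (k + 1) ≫ P.complex.d (k + 1) k ≫ ModuleCat.ofHom s = 0 := by simp
      exact ModuleCat.hom_ext_iff.1 this
  have hex' := Module.Flat.rTensor_exact F hex
  obtain ⟨t, ht⟩ := (rTensorHomToHomRTensor_bijective (P.complex.X (k + 1)) B F).2
    (P.complex.pOpcycles (k + 1) ≫ φ).hom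
  have ht₀ : (LinearMap.lcomp R B d₂).rTensor F t = 0 := by
    apply (rTensorHomToHomRTensor_bijective (P.complex.X (k + 2)) B F).1
    rw [← rTensorHomToHomRTensor_comp, ht, map_zero]
    have : P.complex.d (k + 2) (k + 1) ≫ P.complex.pOpcycles (k + 1) ≫ φ = 0 := by simp
    exact ModuleCat.hom_ext_iff.1 this
  obtain ⟨s, rfl⟩ := (hex' t).1 ht₀
  refine ⟨ModuleCat.ofHom (rTensorHomToHomRTensor (.id R) (P.complex.X k) B F s), ?_⟩
  rw [← rTensorHomToHomRTensor_comp] at ht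
  rw [← cancel_epi (P.complex.pOpcycles (k + 1)), P.complex.p_fromOpcycles_assoc]
  exact ModuleCat.hom_ext ht

end Modules

/-! ### C-projective and C-flat modules and complexes -/

section Modules

open TensorProduct

variable {R : Type u} [CommRing R]

instance (C : ModuleCat.{u} R) : (cProjectiveModules C).IsClosedUnderIsomorphisms where
  of_iso := by
    rintro X Y e ⟨P, hP, ⟨f⟩⟩
    exact ⟨P, hP, ⟨e.symm.toLinearEquiv ≪≫ₗ f⟩⟩

instance (C : ModuleCat.{u} R) : (cFlatModules C).IsClosedUnderIsomorphisms where
  of_iso := by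
    rintro X Y e ⟨P, hP, ⟨f⟩⟩
    exact ⟨P, hP, ⟨e.symm.toLinearEquiv ≪≫ₗ f⟩⟩

instance : (projectiveModules R).IsClosedUnderIsomorphisms where
  of_iso {X Y} e h := by
    have : Module.Projective R X := h
    exact Module.Projective.of_equiv e.toLinearEquiv

lemma cFlatModules_of_cProjectiveModules {C X : ModuleCat.{u} R} (h : cProjectiveModules C X) :
    cFlatModules C X := by
  obtain ⟨P, hP, e⟩ := h
  exact ⟨P, inferInstance, e⟩

lemma cProjectiveModules_of_isZero (C : ModuleCat.{u} R) {X : ModuleCat.{u} R} (h : IsZero X) :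
    cProjectiveModules C X := by
  have := ModuleCat.subsingleton_of_isZero h
  exact ⟨ModuleCat.of R PUnit, inferInstanceAs (Module.Projective R PUnit.{u + 1}),
    ⟨{ (0 : X →ₗ[R] C ⊗[R] PUnit.{u + 1}) with
        invFun := 0, left_inv := fun _ => Subsingleton.elim _ _,
        right_inv := fun _ => Subsingleton.elim _ _ }⟩⟩

lemma cProjectiveModules_biprod (C : ModuleCat.{u} R) {X Y : ModuleCat.{u} R}
    (hX : cProjectiveModules C X) (hY : cProjectiveModules C Y) :
    cProjectiveModules C (X ⊞ Y) := by
  obtain ⟨P, hP, ⟨e⟩⟩ := hX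
  obtain ⟨P', hP', ⟨e'⟩⟩ := hY
  exact ⟨ModuleCat.of R (P × P'), inferInstanceAs (Module.Projective R (P × P')),
    ⟨(ModuleCat.biprodIsoProd X Y).toLinearEquiv ≪≫ₗ e.prodCongr e' ≪≫ₗ
      (TensorProduct.prodRight R R C P P').symm⟩⟩

/-- `Ext^n(X, B) = 0` for `n ≥ 1`, `X` a `C`-projective module and `B` a `C`-flat module. -/
lemma IsSemidualizing.extOrthogonal {C : ModuleCat.{u} R} (hC : IsSemidualizing C)
    {X B : ModuleCat.{u} R} (hX : cProjectiveModules C X) (hB : cFlatModules C B) :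
    ExtOrthogonal.{u} X B := by
  obtain ⟨P, hP, ⟨e⟩⟩ := hX
  obtain ⟨F, hF, ⟨f⟩⟩ := hB
  obtain ⟨T, hT⟩ := hC.exists_resolution
  have h : ExtOrthogonal.{u} C C := fun n => hC.ext_eq_zero (n + 1) (by lia)
  exact (((h.tensor_flat T hT F).tensor_projective P).of_iso e.toModuleIso).of_retract_right
    (Retract.ofIso f.toModuleIso)

lemma exists_section_of_projective {K : ChainComplex (ModuleCat.{u} R) ℤ}
    (hK : projectiveComplexes R K)
    (i j : ℤ) (hij : i + 1 = j) :
    ∃ s : K.cycles i ⟶ K.X j, s ≫ K.toCycles j i = 𝟙 _ := by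
  have : Epi (K.toCycles j i) := (shortExact_cycles K hK.1 hij).epi_g
  have : Module.Projective R (K.cycles i) := hK.2 i
  exact ⟨Projective.factorThru (𝟙 _) (K.toCycles j i), Projective.factorThru_comp _ _⟩

lemma projective_of_projectiveComplexes {K : ChainComplex (ModuleCat.{u} R) ℤ}
    (hK : projectiveComplexes R K) : Projective K := by
  obtain ⟨r⟩ := nonempty_retract_contractible K hK.1 (exists_section_of_projective hK)
  have (i : ℤ) : Module.Projective R (K.cycles i) := hK.2 i
  have : Projective (contractible fun i => K.cycles i) :=
    contractible.projective fun i => ModuleCat.projective_of_categoryTheory_projective _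
  exact r.projective

lemma exists_projectiveComplexes_epi (K : ChainComplex (ModuleCat.{u} R) ℤ) :
    ∃ (P : ChainComplex (ModuleCat.{u} R) ℤ) (p : P ⟶ K), projectiveComplexes R P ∧ Epi p := by
  -- The index is raised by one because the second summand in degree i is M (i - 1), which must
  -- cover K.X i.
  obtain ⟨p, hp⟩ := contractible.exists_hom_from (K := K)
    (M := fun i => Projective.over (K.X (i + 1)))
    fun i => Projective.π (K.X (i - 1 + 1)) ≫ eqToHom (by rw [sub_add_cancel])
  refine ⟨_, p, contractible.mem_tildeClass fun i => ?_, ?_⟩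
  · exact ModuleCat.projective_of_module_projective _
  · exact HomologicalComplex.epi_of_epi_f p fun i => epi_of_epi_fac (hp i)

/-- C-projective modules are C-flat, so Ext^1 between the cycles vanishes and the cycle sequences
split. -/
lemma exists_section_of_cProjective {C : ModuleCat.{u} R} (hC : IsSemidualizing C)
    {K : ChainComplex (ModuleCat.{u} R) ℤ} (hK : cProjectiveComplexes C K)
    (i j : ℤ) (hij : i + 1 = j) :
    ∃ s : K.cycles i ⟶ K.X j, s ≫ K.toCycles j i = 𝟙 _ :=
  exists_lift_of_ext_one (shortExact_cycles K hK.1 hij)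
    (hC.extOrthogonal (hK.2 i) (cFlatModules_of_cProjectiveModules (hK.2 j)) 0) (𝟙 _)

/-- The terms of an acyclic complex with split short exact sequences of cycles. -/
lemma nonempty_iso_biprod_cycles {A : Type*} [Category A] [Abelian A] (K : ChainComplex A ℤ)
    (hK : K.Acyclic) {i j : ℤ} (hij : i + 1 = j)
    (h : ∃ s : K.cycles i ⟶ K.X j, s ≫ K.toCycles j i = 𝟙 _) :
    Nonempty (K.X j ≅ K.cycles j ⊞ K.cycles i) := by
  obtain ⟨s, hs⟩ := h
  have hS := shortExact_cycles K hK hij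
  exact ⟨(ShortComplex.Splitting.ofExactOfSection _ hS.exact s hs hS.mono_f).isoBinaryBiproduct⟩

lemma projectiveModules_X {K : ChainComplex (ModuleCat.{u} R) ℤ} (hK : projectiveComplexes R K)
    (j : ℤ) : projectiveModules R (K.X j) := by
  obtain ⟨e⟩ := nonempty_iso_biprod_cycles K hK.1 (i := j - 1) (j := j) (by lia)
    (exists_section_of_projective hK _ _ (by lia))
  have (i : ℤ) : Module.Projective R (K.cycles i) := hK.2 i
  have : Projective (K.cycles j ⊞ K.cycles (j - 1)) := inferInstance
  have := Projective.of_iso e.symm this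
  exact ModuleCat.projective_of_module_projective _

lemma cProjectiveModules_X {C : ModuleCat.{u} R} (hC : IsSemidualizing C)
    {K : ChainComplex (ModuleCat.{u} R) ℤ} (hK : cProjectiveComplexes C K)
    (j : ℤ) : cProjectiveModules C (K.X j) := by
  obtain ⟨e⟩ := nonempty_iso_biprod_cycles K hK.1 (i := j - 1) (j := j) (by lia)
    (exists_section_of_cProjective hC hK _ _ (by lia))
  exact (cProjectiveModules C).prop_of_iso e.symm
    (cProjectiveModules_biprod C (hK.2 j) (hK.2 (j - 1)))

/-- The terms of a `C`-flat complex are right orthogonal to every module which is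
left orthogonal to the `C`-flat modules. -/
lemma extOrthogonal_X {C M : ModuleCat.{u} R}
    (hM : ∀ B, cFlatModules C B → ExtOrthogonal.{u} M B)
    {H : ChainComplex (ModuleCat.{u} R) ℤ} (hH : cFlatComplexes C H) (j : ℤ) :
    ExtOrthogonal.{u} M (H.X j) :=
  .right_X₂ (shortExact_cycles H hH.1 (i := j - 1) (j := j) (by lia))
    (hM _ (hH.2 j)) (hM _ (hH.2 (j - 1)))

/-- Splitting the cycle sequences makes K a retract of the contractible complex on its cycles, which
reduces the claim to modules. -/
lemma IsSemidualizing.extOrthogonal_complex {C : ModuleCat.{u} R} (hC : IsSemidualizing C)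
    {K H : ChainComplex (ModuleCat.{u} R) ℤ} (hK : cProjectiveComplexes C K)
    (hH : cFlatComplexes C H) : ExtOrthogonal.{u} K H := by
  obtain ⟨r⟩ := nonempty_retract_contractible K hK.1 (exists_section_of_cProjective hC hK)
  exact .of_retract r (.contractible_left H fun i =>
    extOrthogonal_X (fun B hB => hC.extOrthogonal (hK.2 _) hB) hH i)

lemma IsDCProjectiveComplex.isDCProjectiveModule {C : ModuleCat.{u} R} (hC : IsSemidualizing C)
    {X : ChainComplex (ModuleCat.{u} R) ℤ} (hX : IsDCProjectiveComplex C X) (i : ℤ) :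
    IsDCProjectiveModule C (X.X i) :=
  hasCompleteResolution_X i (fun _ hK => projectiveModules_X hK i)
    (fun _ hK => cProjectiveModules_X hC hK i)
    (fun _ hB => contractible.mem_tildeClass fun _ => hB) hX

lemma isDCProjectiveComplex_iff {C : ModuleCat.{u} R} (hC : IsSemidualizing C)
    (X : ChainComplex (ModuleCat.{u} R) ℤ) : IsDCProjectiveComplex C X ↔
      HasOrthogonalCoresolution.{u} (cProjectiveComplexes C) (cFlatComplexes C) X :=
  ⟨hasOrthogonalCoresolution_of_hasCompleteResolution
      (fun _ => projective_of_projectiveComplexes) (fun _ _ => hC.extOrthogonal_complex),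
    hasCompleteResolution_of_hasOrthogonalCoresolution (P := projectiveComplexes R)
      (fun _ => projective_of_projectiveComplexes) exists_projectiveComplexes_epi⟩

lemma IsDCProjectiveModule.extOrthogonal {C : ModuleCat.{u} R} (hC : IsSemidualizing C)
    {M B : ModuleCat.{u} R} (hM : IsDCProjectiveModule C M) (hB : cFlatModules C B) :
    ExtOrthogonal.{u} M B :=
  (hasOrthogonalCoresolution_of_hasCompleteResolution (P := projectiveModules R)
    (fun X (_ : Module.Projective R X) => ModuleCat.projective_of_categoryTheory_projective X)
    (fun _ _ => hC.extOrthogonal) hM).extOrthogonal hB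

end Modules

end DingC

theorem corollary2p12 {R : Type u} [CommRing R] (C : ModuleCat.{u} R)
    (hC : DingC.IsSemidualizing C)
    (S : ShortComplex (ChainComplex (ModuleCat.{u} R) ℤ)) (hS : S.ShortExact)
    (hX : DingC.IsDCProjectiveComplex C S.X₁) (hY : DingC.IsDCProjectiveComplex C S.X₂) :
    List.TFAE [
      DingC.IsDCProjectiveComplex C S.X₃,
      ∀ i : ℤ, DingC.IsDCProjectiveModule C (S.X₃.X i),
      ∀ H : ChainComplex (ModuleCat.{u} R) ℤ, DingC.cFlatComplexes C H →
        Subsingleton (Abelian.Ext.{u} S.X₃ H 1)] := by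
  have hX' := (DingC.isDCProjectiveComplex_iff hC _).1 hX
  have hY' := (DingC.isDCProjectiveComplex_iff hC _).1 hY
  tfae_have 1 → 2 := fun h => h.isDCProjectiveModule hC
  -- The shift of H is again C-flat, so X is orthogonal to it, as the lifting step needs.
  tfae_have 2 → 3 := fun h H hH => DingC.ext_one_of_degreewise hS
    (hX'.extOrthogonal (DingC.tildeClass_shiftComplex hH) 0) (hY'.extOrthogonal hH 0)
    fun i => DingC.extOrthogonal_X (fun B hB => (h i).extOrthogonal hC hB) hH (i + 1) 0
  tfae_have 3 → 1 := fun h => (DingC.isDCProjectiveComplex_iff hC _).2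
    (.of_shortExact
      (fun _ hK => ⟨hK.1, fun i => DingC.cFlatModules_of_cProjectiveModules (hK.2 i)⟩)
      (fun _ _ => hC.extOrthogonal_complex)
      (fun _ => DingC.tildeClass_of_isZero fun _ => DingC.cProjectiveModules_of_isZero C)
      (fun _ _ => DingC.tildeClass_biprod fun _ _ => DingC.cProjectiveModules_biprod C)
      hS hX' hY' h)
  tfae_finish
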